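/- Let $F$ be the free group on the generators $x_i, y_i$ ($i = 0, 1, 2, \dots$), and let $S=\{x_i^{\pm1},y_i^{\pm1}\}$. A \emph{folding} of a word $l_1\cdots l_n$ over the alphabet $S$ is a set $\mathcal F$ of pairwise disjoint pairs $\{i,j\}$ with $1\le i<j\le n$ such that $l_i=l_j^{-1}$ for every $\{i,j\}\in\mathcal F$ and such that no two pairs $\{i,j\},\{k,l\}\in\mathcal F$ satisfy $i<k<j<l$. The \emph{cancellation norm} $\|w\|$ of a word $w$ is the minimum, over all foldings of $w$, of the number of positions that lie in no pair of the folding. It depends only on the element of $F$ that the word represents, and the cancellation norm $\|g\|$ of $g\in F$ is the cancellation norm of any word over $S$ representing $g$. Let $m\ge 2$ be an integer. For each $j\ge 0$ put $T_j=(x_jy_j)^m(y_jx_j)^{-m}\in F$, and let $f_j:F\to F$ be the group homomorphism such that, for every $i\ge 0$ and every $a_i\in\{x_i,y_i\}$, $$f_j(a_i)=\begin{cases}T_j^{-1}a_i&\text{if both } i \text{ and } j \text{ are odd},\\ a_iT_j&\text{otherwise.}\end{cases}$$ Let $\overline w=(f_{2m}\circ f_{2m-1}\circ\cdots\circ f_3)(x_0)\in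 F$. Then: (a) $\overline w$ is represented by a word over $S$ of length $(4m+1)^{2m-2}$; (b) $m^2-3m+5\le\|\overline w\|\le 4m^2-8m+5$; (c) $2m-2\le\|\overline w^2\|\le 8m-4$. -/

import Mathlib

namespace CancellationNorm

/-- The formal inverse of a letter of the symmetric alphabet `α ⊔ α⁻¹`: the letter `(a, true)`
is the generator `a`, the letter `(a, false)` is its inverse. -/
def letterInv {α : Type*} (l : α × Bool) : α × Bool := (l.1, !l.2)

/-- Two pairs of positions `{i, j}` with `i < j` and `{k, l}` with `k < l`, written in increasing
order as `(i, j)` and `(k, l)`, are linked if `i < k < j < l` or `k < i < l < j`. -/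
def Linked {n : ℕ} (p q : Fin n × Fin n) : Prop :=
  (p.1 < q.1 ∧ q.1 < p.2 ∧ p.2 < q.2) ∨ (q.1 < p.1 ∧ p.1 < q.2 ∧ q.2 < p.2)

/-- A folding of the word `w`: a collection of pairwise disjoint, pairwise not linked pairs of
positions, each pair carrying two mutually inverse letters. The unordered pair `{i, j}` is recorded
as `(i, j)` with `i < j`. -/
structure IsFolding {α : Type*} (w : List (α × Bool))
    (F : Finset (Fin w.length × Fin w.length)) : Prop where
  lt : ∀ p ∈ F, p.1 < p.2
  inv : ∀ p ∈ F, w.get p.1 = letterInv (w.get p.2)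
  disjoint : ∀ p ∈ F, ∀ q ∈ F, p ≠ q → p.1 ≠ q.1 ∧ p.1 ≠ q.2 ∧ p.2 ≠ q.1 ∧ p.2 ≠ q.2
  not_linked : ∀ p ∈ F, ∀ q ∈ F, ¬ Linked p q

/-- The positions that belong to none of the pairs of `F`. -/
def unpaired {n : ℕ} (F : Finset (Fin n × Fin n)) : Finset (Fin n) :=
  Finset.univ.filter fun i => ∀ p ∈ F, p.1 ≠ i ∧ p.2 ≠ i

theorem isFolding_empty {α : Type*} (w : List (α × Bool)) : IsFolding w ∅ :=
  ⟨by simp, by simp, by simp, by simp⟩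

/-- The cancellation norm of a word: the least number of unpaired positions in a folding of it
(the minimum of a set of natural numbers that is nonempty, by `isFolding_empty`). -/
noncomputable def wordNorm {α : Type*} (w : List (α × Bool)) : ℕ :=
  sInf {k : ℕ | ∃ F : Finset (Fin w.length × Fin w.length),
    IsFolding w F ∧ (unpaired F).card = k}

/-- The cancellation norm on the free group on `α`, that is the cancellation norm of a word that
represents `g`. The norm is the same for all words representing `g`; we evaluate it at the reduced
word. -/
noncomputable def cancellationNorm {α : Type*} [DecidableEq α] (g : FreeGroup α) : ℕ :=
  wordNorm g.toWord

/-- The generators `x_i`, `y_i` for `i = 0, 1, 2, …`. -/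
inductive Gen : Type
  | x (i : ℕ)
  | y (i : ℕ)
  deriving DecidableEq

/-- The index `i` of the generator `x_i` or `y_i`. -/
def Gen.index : Gen → ℕ
  | Gen.x i => i
  | Gen.y i => i

/-- The free group `F` on all the `x_i`, `y_i`. -/
abbrev F : Type := FreeGroup Gen

/-- The element `x_i` of `F`. -/
def x (i : ℕ) : F := FreeGroup.of (Gen.x i)

/-- The element `y_i` of `F`. -/
def y (i : ℕ) : F := FreeGroup.of (Gen.y i)

/-- The twisted element `T_i = (x_i y_i)^m (y_i x_i)^{-m}`. -/
def T (m i : ℕ) : F := (x i * y i) ^ m * ((y i * x i) ^ m)⁻¹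

/-- The homomorphism `f_j`, with `f_j (a_i) = T_j⁻¹ a_i` if `i` and `j` are both odd and
`f_j (a_i) = a_i T_j` otherwise, for `a_i` equal to `x_i` or `y_i`. -/
def f (m j : ℕ) : F →* F :=
  FreeGroup.lift fun a : Gen =>
    if Odd a.index ∧ Odd j then (T m j)⁻¹ * FreeGroup.of a else FreeGroup.of a * T m j

/-- The composition `f_{j+n} ∘ ⋯ ∘ f_{j+2} ∘ f_{j+1}` of `n` maps (`f_{j+1}` is applied first). -/
def fComp (m j : ℕ) : ℕ → (F →* F)
  | 0 => MonoidHom.id F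
  | n + 1 => (f m (j + n + 1)).comp (fComp m j n)

/-- `f^{(j)} = f_{2m} ∘ ⋯ ∘ f_{j+1}` for `j ≤ 2m`. -/
def fUp (m j : ℕ) : F →* F := fComp m j (2 * m - j)

/-- The element `w̄ = f^{(2)}(x_0) = (f_{2m} ∘ ⋯ ∘ f_3)(x_0)`. -/
def wBar (m : ℕ) : F := fUp m 2 (x 0)

end CancellationNorm

/-! The norm of `g` is the least number of letters whose conjugates multiply to `g`. Foldings,
deletions that make a word trivial, and such factorizations convert into one another
(`IsFolding.exists_isConjProd`, `IsConjProd.trivialUpTo`, `TrivialUpTo.exists_fold`,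
`Fold.wordNorm_le`). Hence the norm is subadditive and conjugation invariant, and `‖g h⁻¹‖` is a
bi-invariant distance, written `Near`.

Peeling off the innermost substitution first gives `w̄ = x_0 R`, where `R` is the product of all
later twisted elements (`fComp_of`, `wBar_eq`). Each level extends `R`, and the products `E` and `O`
over even and odd indices, by one block `(x q y q)^m (y q x q)^{-m}`, with `q = R` at even levels
and, up to conjugation, `q = E O⁻¹` at odd ones.

Lower bound in (b). An optimal factorization of the expansion of a word in `R, E, O` loses `s`
letters of the current level and cuts the rest into regions, again words in `R, E, O`, whose norms
add to `s` (`exists_regionProd`). Two facts bound the loss. If the exponent of the blocks is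
nonzero, then `s ≥ 2` (`RegionProd.two_le`). If a character `χ` to the units of the Gaussian
integers has `χ q = -1` and `χ = 1` on the word, and the block exponent is odd, then either `s ≥ 2m`
or `χ` is nontrivial on some region, and then at least two regions are nontrivial modulo 4
(`RegionProd.two_mul_le_or`, `two_le_countP_of_pairChar`). For a class with an odd exponent such a
character exists at one of two consecutive levels (`exists_weights`). So each pair of levels costs 2
per nontrivial region, and moreover either creates a further region or raises the cost to `2m` for
one of them. Induction on the number of pairs yields a quadratic bound (`le_sum_cancellationNorm`).

Upper bound in (b). Deleting two letters turns a block into a commutator with `q`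
(`exists_near_twist_commutator`), so that `R` times an even block becomes a conjugate of `R`, at
cost 2. An odd block is erased at cost `4m`, except that the last four levels together cost at most
16.

In (c), `R² = (R c)(c⁻¹ R)` with `c = O⁻¹ E`. Each level raises the norm of only one factor, by at
most 4 (`cancellationNorm_gap_add_le`). Conversely, every index from 3 to `2m` must occur in a
factorization, since killing the other letters leaves `T_j² ≠ 1`. Part (a) only multiplies lengths.
-/

namespace CancellationNorm

open FreeGroup

/-! ### Words that become trivial after deletions -/

section Words

variable {α : Type*}

@[simp]
theorem letterInv_letterInv (l : α × Bool) : letterInv (letterInv l) = l := by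
  simp [letterInv]

theorem mk_letterInv (l : α × Bool) : FreeGroup.mk [letterInv l] = (FreeGroup.mk [l])⁻¹ := by
  simp [letterInv, FreeGroup.inv_mk, FreeGroup.invRev]

@[simp]
theorem mk_nil_eq_one : (FreeGroup.mk [] : FreeGroup α) = 1 := rfl

theorem mk_cons (l : α × Bool) (w : List (α × Bool)) :
    FreeGroup.mk (l :: w) = FreeGroup.mk [l] * FreeGroup.mk w := by
  simp [FreeGroup.mul_mk]

theorem mk_append (u v : List (α × Bool)) :
    FreeGroup.mk (u ++ v) = FreeGroup.mk u * FreeGroup.mk v := by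
  simp [FreeGroup.mul_mk]

/-- `IsConjProd ls g`: the element `g` is a product of conjugates of the letters in `ls`. -/
inductive IsConjProd : List (α × Bool) → FreeGroup α → Prop
  | one : IsConjProd [] 1
  | cons (l : α × Bool) (c : FreeGroup α) {ls : List (α × Bool)} {g : FreeGroup α} :
      IsConjProd ls g → IsConjProd (l :: ls) (c * FreeGroup.mk [l] * c⁻¹ * g)

theorem IsConjProd.mul {ls ls' : List (α × Bool)} {g h : FreeGroup α}
    (hg : IsConjProd ls g) (hh : IsConjProd ls' h) : IsConjProd (ls ++ ls') (g * h) := by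
  induction hg with
  | one => simpa using hh
  | cons l c _ ih => simpa [mul_assoc] using IsConjProd.cons l c ih

theorem IsConjProd.conj {ls : List (α × Bool)} {g : FreeGroup α}
    (hg : IsConjProd ls g) (d : FreeGroup α) : IsConjProd ls (d * g * d⁻¹) := by
  induction hg with
  | one => simpa using IsConjProd.one
  | cons l c _ ih =>
    have := IsConjProd.cons l (d * c) ih
    simpa [mul_assoc] using this

theorem IsConjProd.letter (l : α × Bool) : IsConjProd [l] (FreeGroup.mk [l]) := by
  simpa using IsConjProd.cons l 1 IsConjProd.one

/-- Traces the surviving letter backwards through the reduction: each cancelled pair lay wholly to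
its left or wholly to its right. -/
theorem Red.exists_eq_append_cons_append {L : List (α × Bool)} {l : α × Bool}
    (h : FreeGroup.Red L [l]) :
    ∃ p q, L = p ++ l :: q ∧ FreeGroup.Red p [] ∧ FreeGroup.Red q [] := by
  induction h using Relation.ReflTransGen.head_induction_on with
  | refl => exact ⟨[], [], rfl, .refl, .refl⟩
  | head hs _ ih =>
    obtain ⟨p, q, hpq, hp, hq⟩ := ih
    cases hs with
    | @not L₁ L₂ x b =>
      rcases List.append_eq_append_iff.1 hpq with ⟨as, rfl, h2⟩ | ⟨as, rfl, h2⟩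
      · exact ⟨L₁ ++ (x, b) :: (x, !b) :: as, q, by simp [h2],
          Relation.ReflTransGen.head (FreeGroup.Red.Step.not) hp, hq⟩
      · cases as with
        | nil =>
          simp only [List.nil_append] at h2
          refine ⟨p ++ (x, b) :: (x, !b) :: [], q, by simp [← h2],
            Relation.ReflTransGen.head (FreeGroup.Red.Step.not) (by rw [List.append_nil]; exact hp), hq⟩
        | cons a as =>
          simp only [List.cons_append, List.cons.injEq] at h2
          obtain ⟨rfl, rfl⟩ := h2
          exact ⟨p, as ++ (x, b) :: (x, !b) :: L₂, by simp, hp,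
            Relation.ReflTransGen.head (FreeGroup.Red.Step.not) hq⟩

theorem red_nil_of_mk_eq_one {L : List (α × Bool)} (h : FreeGroup.mk L = 1) :
    FreeGroup.Red L [] := by
  obtain ⟨r, h1, h2⟩ := FreeGroup.Red.exact.1 (show FreeGroup.mk L = FreeGroup.mk [] from h)
  rw [FreeGroup.Red.nil_iff] at h2
  exact h2 ▸ h1

theorem mk_eq_one_of_red_nil {L : List (α × Bool)} (h : FreeGroup.Red L []) :
    FreeGroup.mk L = 1 :=
  FreeGroup.Red.exact.2 ⟨[], h, .refl⟩

/-- The tail reduces to the inverse of the first letter; the occurrence that survives is the partner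
of that letter. -/
theorem exists_match_of_mk_cons_eq_one {a : α × Bool} {s : List (α × Bool)}
    (h : FreeGroup.mk (a :: s) = 1) :
    ∃ p q, s = p ++ letterInv a :: q ∧ FreeGroup.mk p = 1 ∧ FreeGroup.mk q = 1 := by
  obtain ⟨x, b⟩ := a
  obtain ⟨p, q, h1, h2, h3⟩ := Red.exists_eq_append_cons_append
    (FreeGroup.Red.cons_nil_iff_singleton.1 (red_nil_of_mk_eq_one h))
  exact ⟨p, q, h1, mk_eq_one_of_red_nil h2, mk_eq_one_of_red_nil h3⟩

/-- Besides the removed letter only its partner has to go. Rotating the word cyclically brings the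
letter to the front, where the partner can be found. -/
theorem exists_sublist_of_mk_append_cons_eq_one {a : α × Bool} {s t : List (α × Bool)}
    (h : FreeGroup.mk (s ++ a :: t) = 1) :
    ∃ r, r.Sublist (s ++ t) ∧ FreeGroup.mk r = 1 ∧ (s ++ t).length ≤ r.length + 1 := by
  have h' : FreeGroup.mk (a :: (t ++ s)) = 1 := by
    rw [mk_append, mk_cons] at h
    rw [mk_cons, mk_append]
    have := mul_eq_one_comm.1 h
    simpa [mul_assoc] using this
  obtain ⟨p, q, hpq, hp, hq⟩ := exists_match_of_mk_cons_eq_one h'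
  rcases List.append_eq_append_iff.1 hpq with ⟨as, rfl, h2⟩ | ⟨as, rfl, h2⟩
  · subst h2
    refine ⟨as ++ q ++ t, by simp, ?_, by simp; omega⟩
    rw [mk_append] at hp
    rw [mk_append, mk_append, hq, mul_one]
    exact mul_eq_one_comm.1 hp
  · cases as with
    | nil =>
      simp only [List.nil_append] at h2
      subst h2
      exact ⟨q ++ p, by simp, by rw [mk_append, hp, hq, one_mul], by simp⟩
    | cons b as =>
      simp only [List.cons_append, List.cons.injEq] at h2
      obtain ⟨rfl, rfl⟩ := h2
      refine ⟨s ++ (p ++ as), by simp, ?_, by simp; omega⟩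
      rw [mk_append] at hq
      rw [mk_append, mk_append, hp, one_mul]
      exact mul_eq_one_comm.1 hq

/-- The word `w` becomes trivial after the deletion of at most `k` of its letters. -/
def TrivialUpTo (w : List (α × Bool)) (k : ℕ) : Prop :=
  ∃ s : List (α × Bool), s.Sublist w ∧ FreeGroup.mk s = 1 ∧ w.length ≤ s.length + k

/-- If both or neither of the cancelling letters were kept, the other kept letters already work. If
exactly one was kept, it is dropped together with its partner: word and kept part both lose two
letters. -/
theorem TrivialUpTo.step {w w' : List (α × Bool)} {k : ℕ} (h : TrivialUpTo w k)
    (hs : FreeGroup.Red.Step w w') : TrivialUpTo w' k := by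
  obtain ⟨s, hsub, hs1, hlen⟩ := h
  cases hs with
  | @not u v x b =>
    have e : u ++ (x, b) :: (x, !b) :: v = u ++ ([(x, b), (x, !b)] ++ v) := by simp
    rw [e] at hsub
    obtain ⟨s1, s', rfl, h1, h2⟩ := List.sublist_append_iff.1 hsub
    obtain ⟨s2, s3, rfl, h2, h3⟩ := List.sublist_append_iff.1 h2
    simp only [List.length_append, List.length_cons] at hlen
    have hl1 := h1.length_le
    have hl3 := h3.length_le
    have key : ∀ a : α × Bool, s2 = [a] → TrivialUpTo (u ++ v) k := by
      rintro a rfl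
      obtain ⟨r, hr, hr1, hr2⟩ := exists_sublist_of_mk_append_cons_eq_one hs1
      refine ⟨r, hr.trans (h1.append h3), hr1, ?_⟩
      simp at hr2 hlen ⊢
      omega
    rcases s2 with _ | ⟨a, _ | ⟨b', _ | ⟨c, s2⟩⟩⟩
    · exact ⟨s1 ++ s3, h1.append h3, by simpa using hs1, by simp at hlen ⊢; omega⟩
    · exact key a rfl
    · have hab : [a, b'] = [(x, b), (x, !b)] := h2.eq_of_length (by simp)
      simp only [List.cons.injEq, and_true] at hab
      obtain ⟨rfl, rfl⟩ := hab
      refine ⟨s1 ++ s3, h1.append h3, ?_, by simp at hlen ⊢; omega⟩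
      rw [← hs1]
      exact (Quot.sound (by simp)).symm
    · have := h2.length_le
      simp at this

theorem TrivialUpTo.of_step {w w' : List (α × Bool)} {k : ℕ} (h : TrivialUpTo w' k)
    (hs : FreeGroup.Red.Step w w') : TrivialUpTo w k := by
  obtain ⟨s, hsub, hs1, hlen⟩ := h
  cases hs with
  | @not u v x b =>
    obtain ⟨s1, s3, rfl, h1, h3⟩ := List.sublist_append_iff.1 hsub
    refine ⟨s1 ++ (x, b) :: (x, !b) :: s3, h1.append ((h3.cons_cons _).cons_cons _), ?_, ?_⟩
    · rw [← hs1]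
      exact Quot.sound (by simp)
    · simp at hlen ⊢
      omega

/-- Independence of the representing word: both words reduce to a common one. -/
theorem TrivialUpTo.congr {w w' : List (α × Bool)} {k : ℕ} (h : TrivialUpTo w k)
    (e : FreeGroup.mk w = FreeGroup.mk w') : TrivialUpTo w' k := by
  obtain ⟨r, h1, h2⟩ := FreeGroup.Red.exact.1 e
  have hr : TrivialUpTo r k := by
    clear e h2
    induction h1 with
    | refl => exact h
    | tail _ hs ih => exact ih.step hs
  clear h1 e
  induction h2 using Relation.ReflTransGen.head_induction_on with
  | refl => exact hr
  | head hs _ ih => exact ih.of_step hs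

theorem IsConjProd.exists_trivialUpTo {ls : List (α × Bool)} {g : FreeGroup α}
    (h : IsConjProd ls g) : ∃ w, FreeGroup.mk w = g ∧ TrivialUpTo w ls.length := by
  induction h with
  | one => exact ⟨[], rfl, [], by simp, rfl, by simp⟩
  | cons l c _ ih =>
    obtain ⟨w, rfl, s, hs, hs1, hl⟩ := ih
    obtain ⟨cw, rfl⟩ := Quot.exists_rep c
    refine ⟨cw ++ (l :: (FreeGroup.invRev cw ++ w)), ?_, cw ++ (FreeGroup.invRev cw ++ s), ?_, ?_, ?_⟩
    · rw [mk_append, mk_cons, mk_append, ← FreeGroup.inv_mk]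
      simp only [FreeGroup.quot_mk_eq_mk, mul_assoc]
    · exact (List.Sublist.refl _).append (((List.Sublist.refl _).append hs).cons _)
    · rw [mk_append, mk_append, hs1, ← FreeGroup.inv_mk, mul_one, mul_inv_cancel]
    · simp at hl ⊢
      omega

theorem IsConjProd.trivialUpTo {ls w : List (α × Bool)}
    (h : IsConjProd ls (FreeGroup.mk w)) : TrivialUpTo w ls.length := by
  obtain ⟨w', h1, h2⟩ := h.exists_trivialUpTo
  exact h2.congr h1

/-- A planar decomposition of a word, in which `k` letters are left over. -/
inductive Fold : List (α × Bool) → ℕ → Prop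
  | nil : Fold [] 0
  | skip (a : α × Bool) {u : List (α × Bool)} {k : ℕ} : Fold u k → Fold (a :: u) (k + 1)
  | pair (a : α × Bool) {u v : List (α × Bool)} {k k' : ℕ} :
      Fold u k → Fold v k' → Fold (a :: (u ++ letterInv a :: v)) (k + k')

/-- A deleted first letter is skipped. A kept one is paired with its partner, which cuts the word
into two shorter ones whose kept parts are trivial separately; this is what makes the pairing
planar. -/
theorem TrivialUpTo.exists_fold {w : List (α × Bool)} {k : ℕ} (h : TrivialUpTo w k) :
    ∃ k' ≤ k, Fold w k' := by
  suffices H : ∀ n : ℕ, ∀ w s : List (α × Bool), w.length ≤ n → s.Sublist w →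
      FreeGroup.mk s = 1 → ∃ k', k' + s.length = w.length ∧ Fold w k' by
    obtain ⟨s, h1, h2, h3⟩ := h
    obtain ⟨k', h4, h5⟩ := H _ w s le_rfl h1 h2
    exact ⟨k', by omega, h5⟩
  clear h
  intro n
  induction n with
  | zero =>
    intro w s hw hs _
    obtain rfl : w = [] := by simpa using hw
    obtain rfl : s = [] := by simpa using hs
    exact ⟨0, rfl, .nil⟩
  | succ n ih =>
    intro w s hw hs hs1
    cases hs with
    | slnil => exact ⟨0, rfl, .nil⟩
    | @cons _ w' a hs =>
      obtain ⟨k', h1, h2⟩ := ih w' s (by simpa using hw) hs hs1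
      exact ⟨k' + 1, by simp; omega, .skip a h2⟩
    | @cons_cons s' w' a hs =>
      obtain ⟨p, q, rfl, hp, hq⟩ := exists_match_of_mk_cons_eq_one hs1
      obtain ⟨u, v, rfl, h1, h2⟩ := List.append_sublist_iff.1 hs
      obtain ⟨r1, r2, rfl, h3, h4⟩ := List.cons_sublist_iff.1 h2
      obtain ⟨r11, r12, rfl⟩ := List.append_of_mem h3
      simp only [List.length_append, List.length_cons] at hw
      obtain ⟨k1, hk1, hf1⟩ := ih (u ++ r11) p (by simp; omega) (h1.trans (by simp)) hp
      obtain ⟨k2, hk2, hf2⟩ := ih (r12 ++ r2) q (by simp; omega) (h4.trans (by simp)) hq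
      refine ⟨k1 + k2, ?_, ?_⟩
      · simp at hk1 hk2 ⊢
        omega
      · simpa using Fold.pair a hf1 hf2

end Words

end CancellationNorm
namespace CancellationNorm

open FreeGroup

/-! ### Foldings and products of conjugates of letters -/

section Foldings

variable {α : Type*}

/-- Pairs are natural numbers shifted by an offset `n` and read against a fixed labelling `L`, so
that the pairs of both subwords can be joined without reindexing. -/
theorem Fold.exists_pairs {u : List (α × Bool)} {k : ℕ} (h : Fold u k) :
    ∀ (L : ℕ → α × Bool) (n : ℕ), (∀ i < u.length, u[i]? = some (L (n + i))) →
      ∃ F : Finset (ℕ × ℕ),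
        (∀ p ∈ F, n ≤ p.1 ∧ p.1 < p.2 ∧ p.2 < n + u.length) ∧
        (∀ p ∈ F, L p.1 = letterInv (L p.2)) ∧
        (∀ p ∈ F, ∀ q ∈ F, p ≠ q → p.1 ≠ q.1 ∧ p.1 ≠ q.2 ∧ p.2 ≠ q.1 ∧ p.2 ≠ q.2) ∧
        (∀ p ∈ F, ∀ q ∈ F, ¬ (p.1 < q.1 ∧ q.1 < p.2 ∧ p.2 < q.2)) ∧
        u.length ≤ 2 * F.card + k := by
  induction h with
  | nil => exact fun L n _ => ⟨∅, by simp⟩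
  | @skip a u k _ ih =>
    intro L n hL
    obtain ⟨F, h1, h2, h3, h4, h5⟩ := ih L (n + 1) fun i hi => by
      have := hL (i + 1) (by simpa using hi)
      rw [List.getElem?_cons_succ] at this
      rw [this, add_assoc, add_comm 1 i]
    refine ⟨F, fun p hp => ?_, h2, h3, h4, by simp; omega⟩
    have := h1 p hp
    simp
    omega
  | @pair a u v k k' _ _ ihu ihv =>
    intro L n hL
    obtain ⟨F, h1, h2, h3, h4, h5⟩ := ihu L (n + 1) fun i hi => by
      have := hL (i + 1) (by simp; omega)
      rw [List.getElem?_cons_succ, List.getElem?_append_left hi] at this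
      rw [this, add_assoc, add_comm 1 i]
    obtain ⟨G, g1, g2, g3, g4, g5⟩ := ihv L (n + u.length + 2) fun i hi => by
      have := hL (u.length + 1 + i + 1) (by simp; omega)
      rw [List.getElem?_cons_succ, List.getElem?_append_right (by omega),
        show u.length + 1 + i - u.length = i + 1 by omega, List.getElem?_cons_succ] at this
      rw [this]
      congr 2
      omega
    have e0 : L n = a := by
      have := hL 0 (by simp)
      simpa using this.symm
    have e1 : L (n + u.length + 1) = letterInv a := by
      have := hL (u.length + 1) (by simp)
      rw [List.getElem?_cons_succ, List.getElem?_append_right le_rfl] at this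
      simpa [add_assoc] using this.symm
    have hFG : Disjoint F G := by
      rw [Finset.disjoint_left]
      intro p hp hq
      have := h1 p hp
      have := g1 p hq
      omega
    have hn : (n, n + u.length + 1) ∉ F ∪ G := by
      intro h
      rcases Finset.mem_union.1 h with h | h
      · have := h1 _ h
        simp at this
      · have := g1 _ h
        simp at this
        omega
    have hmem : ∀ p ∈ insert (n, n + u.length + 1) (F ∪ G),
        (p = (n, n + u.length + 1)) ∨ (p ∈ F ∧ n + 1 ≤ p.1 ∧ p.1 < p.2 ∧ p.2 < n + 1 + u.length) ∨
        (p ∈ G ∧ n + u.length + 2 ≤ p.1 ∧ p.1 < p.2 ∧ p.2 < n + u.length + 2 + v.length) := by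
      intro p hp
      rcases Finset.mem_insert.1 hp with h | h
      · exact Or.inl h
      · rcases Finset.mem_union.1 h with h | h
        · exact Or.inr (Or.inl ⟨h, h1 p h⟩)
        · exact Or.inr (Or.inr ⟨h, g1 p h⟩)
    refine ⟨insert (n, n + u.length + 1) (F ∪ G), ?_, ?_, ?_, ?_, ?_⟩
    · intro p hp
      simp only [List.length_cons, List.length_append]
      rcases hmem p hp with rfl | ⟨_, h⟩ | ⟨_, h⟩
      · simp only
        omega
      · omega
      · omega
    · intro p hp
      rcases hmem p hp with rfl | ⟨h, _⟩ | ⟨h, _⟩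
      · simp [e0, e1]
      · exact h2 p h
      · exact g2 p h
    · intro p hp q hq hpq
      rcases hmem p hp with rfl | ⟨h, h'⟩ | ⟨h, h'⟩ <;>
        rcases hmem q hq with rfl | ⟨j, j'⟩ | ⟨j, j'⟩
      · exact absurd rfl hpq
      · simp only
        omega
      · simp only
        omega
      · simp only
        omega
      · exact h3 p h q j hpq
      · omega
      · simp only
        omega
      · omega
      · exact g3 p h q j hpq
    · intro p hp q hq
      rcases hmem p hp with rfl | ⟨h, h'⟩ | ⟨h, h'⟩ <;>
        rcases hmem q hq with rfl | ⟨j, j'⟩ | ⟨j, j'⟩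
      · simp
      · simp only
        omega
      · simp only
        omega
      · simp only
        omega
      · exact h4 p h q j
      · omega
      · simp only
        omega
      · omega
      · exact g4 p h q j
    · rw [Finset.card_insert_of_notMem hn, Finset.card_union_of_disjoint hFG]
      simp only [List.length_cons, List.length_append]
      omega

theorem wordNorm_le_of_isFolding {w : List (α × Bool)}
    {F : Finset (Fin w.length × Fin w.length)} (h : IsFolding w F) :
    wordNorm w ≤ (unpaired F).card :=
  Nat.sInf_le ⟨F, h, rfl⟩

theorem exists_isFolding_card_eq_wordNorm (w : List (α × Bool)) :
    ∃ F : Finset (Fin w.length × Fin w.length),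
      IsFolding w F ∧ (unpaired F).card = wordNorm w :=
  Nat.sInf_mem (s := {k : ℕ | ∃ F : Finset (Fin w.length × Fin w.length),
    IsFolding w F ∧ (unpaired F).card = k}) ⟨_, ∅, isFolding_empty w, rfl⟩

theorem IsFolding.card_unpaired_add_le {w : List (α × Bool)}
    {F : Finset (Fin w.length × Fin w.length)} (h : IsFolding w F) :
    (unpaired F).card + 2 * F.card ≤ w.length := by
  classical
  have c1 : (F.image Prod.fst).card = F.card := Finset.card_image_of_injOn fun p hp q hq e => by
    by_contra hne
    exact (h.disjoint p hp q hq hne).1 e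
  have c2 : (F.image Prod.snd).card = F.card := Finset.card_image_of_injOn fun p hp q hq e => by
    by_contra hne
    exact (h.disjoint p hp q hq hne).2.2.2 e
  have d1 : Disjoint (F.image Prod.fst) (F.image Prod.snd) := by
    rw [Finset.disjoint_left]
    intro i hi hj
    obtain ⟨p, hp, rfl⟩ := Finset.mem_image.1 hi
    obtain ⟨q, hq, e⟩ := Finset.mem_image.1 hj
    by_cases hpq : p = q
    · subst hpq
      exact absurd e (h.lt p hp).ne'
    · exact (h.disjoint p hp q hq hpq).2.1 e.symm
  have d2 : Disjoint (unpaired F) (F.image Prod.fst ∪ F.image Prod.snd) := by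
    rw [Finset.disjoint_left]
    intro i hi hj
    have hi := (Finset.mem_filter.1 hi).2
    rcases Finset.mem_union.1 hj with hj | hj
    · obtain ⟨p, hp, rfl⟩ := Finset.mem_image.1 hj
      exact (hi p hp).1 rfl
    · obtain ⟨p, hp, rfl⟩ := Finset.mem_image.1 hj
      exact (hi p hp).2 rfl
  have := Finset.card_le_univ ((unpaired F) ∪ (F.image Prod.fst ∪ F.image Prod.snd))
  rw [Finset.card_union_of_disjoint d2, Finset.card_union_of_disjoint d1, c1, c2,
    Fintype.card_fin] at this
  omega

theorem Fold.wordNorm_le {w : List (α × Bool)} {k : ℕ} (h : Fold w k) : wordNorm w ≤ k := by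
  classical
  -- A total labelling needs a default letter, taken to be the first one; the empty word is
  -- therefore treated apart.
  rcases w with _ | ⟨a, w⟩
  · refine (wordNorm_le_of_isFolding (isFolding_empty _)).trans ?_
    have := (isFolding_empty ([] : List (α × Bool))).card_unpaired_add_le
    exact (Nat.le_of_add_right_le this).trans (Nat.zero_le k)
  obtain ⟨F, h1, h2, h3, h4, h5⟩ := h.exists_pairs (fun i => ((a :: w)[i]?).getD a) 0
    fun i hi => by simp [List.getElem?_eq_getElem hi]
  set W := a :: w with hW
  let G : Finset (Fin W.length × Fin W.length) :=
    Finset.univ.filter fun p => ((p.1 : ℕ), (p.2 : ℕ)) ∈ F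
  have hG : ∀ p ∈ G, ((p.1 : ℕ), (p.2 : ℕ)) ∈ F := fun p hp => (Finset.mem_filter.1 hp).2
  have hfold : IsFolding W G := by
    constructor
    · intro p hp
      exact (h1 _ (hG p hp)).2.1
    · intro p hp
      simpa using h2 _ (hG p hp)
    · intro p hp q hq hpq
      have := h3 _ (hG p hp) _ (hG q hq) (fun e => hpq (by
        simp only [Prod.mk.injEq] at e
        exact Prod.ext (Fin.ext e.1) (Fin.ext e.2)))
      simpa [Fin.ext_iff] using this
    · intro p hp q hq hl
      rcases hl with hl | hl
      · exact h4 _ (hG p hp) _ (hG q hq) hl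
      · exact h4 _ (hG q hq) _ (hG p hp) hl
  have hcard : F.card ≤ G.card := by
    have : F ⊆ G.image fun p => ((p.1 : ℕ), (p.2 : ℕ)) := by
      intro p hp
      have := h1 p hp
      exact Finset.mem_image.2 ⟨(⟨p.1, by omega⟩, ⟨p.2, by omega⟩), by simpa [G] using hp, rfl⟩
    exact (Finset.card_le_card this).trans Finset.card_image_le
  have := hfold.card_unpaired_add_le
  have := wordNorm_le_of_isFolding hfold
  omega

/-- Replacing letters of a product by `1` only changes it by conjugates of these letters. -/
theorem exists_isConjProd_of_forall_eq_or {ι : Type*} (is : List ι) (l : ι → α × Bool)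
    (U : ι → Prop) [DecidablePred U] :
    ∃ ls, ls.length = (is.filter U).length ∧
      IsConjProd ls ((is.map fun i => FreeGroup.mk [l i]).prod *
        ((is.map fun i => if U i then 1 else FreeGroup.mk [l i]).prod)⁻¹) := by
  induction is with
  | nil => exact ⟨[], by simp, by simpa using IsConjProd.one⟩
  | cons i is ih =>
    obtain ⟨ls, h1, h2⟩ := ih
    by_cases hi : U i
    · refine ⟨l i :: ls, by simp [hi, h1], ?_⟩
      have := (IsConjProd.letter (l i)).mul h2
      simpa [hi, mul_assoc] using this
    · refine ⟨ls, by simp [hi, h1], ?_⟩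
      have := h2.conj (FreeGroup.mk [l i])
      simpa [hi, mul_assoc] using this

theorem mk_eq_prod_map (w : List (α × Bool)) :
    FreeGroup.mk w = (w.map fun l => FreeGroup.mk [l]).prod := by
  induction w with
  | nil => rfl
  | cons a w ih => rw [mk_cons, ih, List.map_cons, List.prod_cons]

/-- Strong induction over intervals closed under the pairing. If the first position is paired, the
parts inside and behind the pair are again closed because no two pairs are linked, and the two ends
cancel. -/
theorem IsFolding.prod_range'_eq_one {w : List (α × Bool)}
    {F : Finset (Fin w.length × Fin w.length)} (h : IsFolding w F) (b : ℕ → FreeGroup α)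
    (hb : ∀ i, i ∈ unpaired F → b i = 1)
    (hb' : ∀ i, i ∉ unpaired F → b i = FreeGroup.mk [w.get i]) (n : ℕ) :
    ∀ i, i + n ≤ w.length →
      (∀ p ∈ F, (i ≤ (p.1 : ℕ) ∧ (p.1 : ℕ) < i + n) ↔ (i ≤ (p.2 : ℕ) ∧ (p.2 : ℕ) < i + n)) →
      ((List.range' i n).map b).prod = 1 := by
  induction n using Nat.strong_induction_on with
  | _ n ih =>
    intro i hin hcl
    rcases n with _ | n
    · simp
    rw [List.range'_succ, List.map_cons, List.prod_cons]
    have hi : i < w.length := by omega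
    by_cases hu : (⟨i, hi⟩ : Fin w.length) ∈ unpaired F
    · have e := hb _ hu
      simp only at e
      rw [e, one_mul]
      refine ih n (by omega) (i + 1) (by omega) fun p hp => ?_
      have h1 := hcl p hp
      have h2 := (Finset.mem_filter.1 hu).2 p hp
      simp only [ne_eq, Fin.ext_iff] at h2
      omega
    · obtain ⟨p, hp, hpi⟩ : ∃ p ∈ F, (p.1 : ℕ) = i := by
        simp only [unpaired, Finset.mem_filter, Finset.mem_univ, true_and, not_forall,
          exists_prop] at hu
        obtain ⟨p, hp, hpi⟩ := hu
        refine ⟨p, hp, ?_⟩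
        by_contra hne
        have h1 := hcl p hp
        have h2 : (p.1 : ℕ) < p.2 := h.lt p hp
        have h3 : (p.2 : ℕ) = i := by
          by_contra h3
          exact hpi ⟨fun e => hne (by rw [e]), fun e => h3 (by rw [e])⟩
        omega
      have hlt : (p.1 : ℕ) < p.2 := h.lt p hp
      have hp2 := (hcl p hp).1 ⟨by omega, by omega⟩
      obtain ⟨t, ht⟩ : ∃ t, (p.2 : ℕ) = i + 1 + t := ⟨p.2 - (i + 1), by omega⟩
      obtain ⟨r, rfl⟩ : ∃ r, n = t + (1 + r) := ⟨n - t - 1, by omega⟩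
      have key : ∀ q ∈ F, q ≠ p → (q.1 : ℕ) ≠ i ∧ (q.1 : ℕ) ≠ i + 1 + t ∧ (q.2 : ℕ) ≠ i ∧
          (q.2 : ℕ) ≠ i + 1 + t := by
        intro q hq hqp
        have := h.disjoint q hq p hp hqp
        simp only [ne_eq, Fin.ext_iff] at this
        omega
      have hnl : ∀ q ∈ F, ¬ ((p.1 : ℕ) < q.1 ∧ (q.1 : ℕ) < p.2 ∧ (p.2 : ℕ) < q.2) ∧
          ¬ ((q.1 : ℕ) < p.1 ∧ (p.1 : ℕ) < q.2 ∧ (q.2 : ℕ) < p.2) := by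
        intro q hq
        have := h.not_linked p hp q hq
        simpa only [Linked, not_or, Fin.lt_def] using this
      have e1 : b i = FreeGroup.mk [w.get p.1] := by
        have := hb' p.1 (fun hu' => ((Finset.mem_filter.1 hu').2 p hp).1 rfl)
        rwa [hpi] at this
      have e2 : b (i + 1 + t) = FreeGroup.mk [w.get p.2] := by
        have := hb' p.2 (fun hu' => ((Finset.mem_filter.1 hu').2 p hp).2 rfl)
        rwa [ht] at this
      rw [← List.range'_append_1, List.map_append, List.prod_append,
        ← List.range'_append_1, List.map_append, List.prod_append, List.range'_one,
        ih t (by omega) (i + 1) (by omega), ih r (by omega) (i + 1 + t + 1) (by omega)]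
      · rw [e1, List.map_singleton, List.prod_singleton, e2, h.inv p hp, mk_letterInv]
        simp only [one_mul, mul_one, inv_mul_cancel]
      · intro q hq
        by_cases hqp : q = p
        · subst hqp
          omega
        · have h1 := hcl q hq
          have h2 := key q hq hqp
          have h3 := hnl q hq
          have h4 : (q.1 : ℕ) < q.2 := h.lt q hq
          omega
      · intro q hq
        by_cases hqp : q = p
        · subst hqp
          omega
        · have h1 := hcl q hq
          have h2 := key q hq hqp
          have h3 := hnl q hq
          have h4 : (q.1 : ℕ) < q.2 := h.lt q hq
          omega

/-- Replacing the unpaired letters by `1` makes the product trivial and changes it only by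
conjugates of those letters. -/
theorem IsFolding.exists_isConjProd {w : List (α × Bool)}
    {F : Finset (Fin w.length × Fin w.length)} (h : IsFolding w F) :
    ∃ ls, ls.length = (unpaired F).card ∧ IsConjProd ls (FreeGroup.mk w) := by
  classical
  obtain ⟨ls, h1, h2⟩ := exists_isConjProd_of_forall_eq_or (List.finRange w.length) w.get
    (· ∈ unpaired F)
  refine ⟨ls, ?_, ?_⟩
  · rw [h1, ← List.toFinset_card_of_nodup ((List.nodup_finRange _).filter _)]
    congr 1
    ext i
    simp
  · have e1 : ((List.finRange w.length).map fun i => FreeGroup.mk [w.get i]).prod =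
        FreeGroup.mk w := by
      rw [mk_eq_prod_map w]
      conv_rhs => rw [← List.map_get_finRange w, List.map_map]
      rfl
    let b : ℕ → FreeGroup α := fun i =>
      if hi : i < w.length then
        (if (⟨i, hi⟩ : Fin w.length) ∈ unpaired F then 1 else FreeGroup.mk [w.get ⟨i, hi⟩])
      else 1
    have e2 : ((List.finRange w.length).map fun i =>
        if i ∈ unpaired F then 1 else FreeGroup.mk [w.get i]).prod = 1 := by
      have := h.prod_range'_eq_one b (fun i hi => by simp [b, hi]) (fun i hi => by simp [b, hi])
        w.length 0 (by simp) (fun p hp => by simp)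
      rw [← List.range_eq_range', ← List.map_coe_finRange_eq_range, List.map_map] at this
      refine Eq.trans ?_ this
      congr 1
      refine List.map_congr_left fun i _ => ?_
      simp [b]
    rw [e1, e2] at h2
    simpa using h2

variable [DecidableEq α]

theorem exists_isConjProd (g : FreeGroup α) :
    ∃ ls, ls.length = cancellationNorm g ∧ IsConjProd ls g := by
  obtain ⟨F, h1, h2⟩ := exists_isFolding_card_eq_wordNorm g.toWord
  obtain ⟨ls, h3, h4⟩ := h1.exists_isConjProd
  exact ⟨ls, h3.trans h2, by rwa [FreeGroup.mk_toWord] at h4⟩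

theorem IsConjProd.cancellationNorm_le {ls : List (α × Bool)} {g : FreeGroup α}
    (h : IsConjProd ls g) : cancellationNorm g ≤ ls.length := by
  rw [← FreeGroup.mk_toWord (x := g)] at h
  obtain ⟨k, hk, hf⟩ := h.trivialUpTo.exists_fold
  exact hf.wordNorm_le.trans hk

/-- Gives the deletions for any representing word, not only for the reduced word used in the
definition of the norm. -/
theorem trivialUpTo_cancellationNorm (w : List (α × Bool)) :
    TrivialUpTo w (cancellationNorm (FreeGroup.mk w)) := by
  obtain ⟨ls, h1, h2⟩ := exists_isConjProd (FreeGroup.mk w)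
  exact h1 ▸ h2.trivialUpTo

@[simp]
theorem cancellationNorm_one : cancellationNorm (1 : FreeGroup α) = 0 :=
  Nat.le_zero.1 IsConjProd.one.cancellationNorm_le

theorem cancellationNorm_mk_singleton_le (l : α × Bool) :
    cancellationNorm (FreeGroup.mk [l]) ≤ 1 :=
  (IsConjProd.letter l).cancellationNorm_le

theorem cancellationNorm_mul_le (g h : FreeGroup α) :
    cancellationNorm (g * h) ≤ cancellationNorm g + cancellationNorm h := by
  obtain ⟨ls, h1, h2⟩ := exists_isConjProd g
  obtain ⟨ls', h3, h4⟩ := exists_isConjProd h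
  have := (h2.mul h4).cancellationNorm_le
  rw [List.length_append] at this
  omega

theorem cancellationNorm_conj_le (g h : FreeGroup α) :
    cancellationNorm (h * g * h⁻¹) ≤ cancellationNorm g := by
  obtain ⟨ls, h1, h2⟩ := exists_isConjProd g
  exact h1 ▸ (h2.conj h).cancellationNorm_le

end Foldings

end CancellationNorm
namespace CancellationNorm

open FreeGroup

/-! ### Splitting an expanded word into regions -/

section Splitting

variable {α β γ : Type*}

/-- The words of length one over the second half of the alphabet. -/
def rightLetter (b : β × Bool) : FreeGroup (γ ⊕ β) := FreeGroup.mk [(Sum.inr b.1, b.2)]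

/-- `RegionProd s us g`: the element `g` is a product of conjugates of `s` letters of `β` and of
conjugates of the elements `us` of the free group on `γ`. -/
inductive RegionProd : ℕ → List (FreeGroup γ) → FreeGroup (γ ⊕ β) → Prop
  | one : RegionProd 0 [] 1
  | letter (b : β × Bool) (c : FreeGroup (γ ⊕ β)) {s : ℕ} {us : List (FreeGroup γ)}
      {g : FreeGroup (γ ⊕ β)} :
      RegionProd s us g → RegionProd (s + 1) us (c * rightLetter b * c⁻¹ * g)
  | region (v : FreeGroup γ) (c : FreeGroup (γ ⊕ β)) {s : ℕ} {us : List (FreeGroup γ)}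
      {g : FreeGroup (γ ⊕ β)} :
      RegionProd s us g → RegionProd s (v :: us) (c * FreeGroup.map Sum.inl v * c⁻¹ * g)

theorem RegionProd.mul {s s' : ℕ} {us us' : List (FreeGroup γ)} {g h : FreeGroup (γ ⊕ β)}
    (hg : RegionProd s us g) (hh : RegionProd s' us' h) :
    RegionProd (s + s') (us ++ us') (g * h) := by
  induction hg with
  | one => simpa using hh
  | letter b c _ ih =>
    have := RegionProd.letter b c ih
    rw [add_right_comm, mul_assoc]
    exact this
  | region v c _ ih =>
    have := RegionProd.region v c ih
    rw [mul_assoc]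
    exact this

theorem RegionProd.conj {s : ℕ} {us : List (FreeGroup γ)} {g : FreeGroup (γ ⊕ β)}
    (hg : RegionProd s us g) (d : FreeGroup (γ ⊕ β)) : RegionProd s us (d * g * d⁻¹) := by
  induction hg with
  | one => simpa using RegionProd.one
  | @letter b c s us g _ ih =>
    have := RegionProd.letter b (d * c) ih
    have e : d * (c * rightLetter b * c⁻¹ * g) * d⁻¹ =
      d * c * rightLetter b * (d * c)⁻¹ * (d * g * d⁻¹) := by group
    rwa [e]
  | @region v c s us g _ ih =>
    have := RegionProd.region v (d * c) ih
    have e : d * (c * FreeGroup.map Sum.inl v * c⁻¹ * g) * d⁻¹ =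
      d * c * FreeGroup.map Sum.inl v * (d * c)⁻¹ * (d * g * d⁻¹) := by group
    rwa [e]

/-- Match the first letter and descend into the part that still has letters with `P`; if the part
enclosed by a matched `P`-letter has none, that match is innermost. -/
theorem exists_innermost_match (P : α → Prop) (n : ℕ) : ∀ L : List (α × Bool), L.length ≤ n →
    FreeGroup.mk L = 1 → (∃ l ∈ L, P l.1) →
    ∃ p b q t, L = p ++ b :: (q ++ letterInv b :: t) ∧ P b.1 ∧ (∀ l ∈ q, ¬ P l.1) ∧
      FreeGroup.mk q = 1 := by
  induction n with
  | zero =>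
    rintro L hL _ ⟨l, hl, _⟩
    obtain rfl : L = [] := by simpa using hL
    simp at hl
  | succ n ih =>
    intro L hL h1 hP
    rcases L with _ | ⟨a, L⟩
    · simp at hP
    obtain ⟨p0, q0, rfl, hp, hq⟩ := exists_match_of_mk_cons_eq_one h1
    simp only [List.length_cons, List.length_append] at hL
    by_cases hp0 : ∃ l ∈ p0, P l.1
    · obtain ⟨p, b, q, t, rfl, h2, h3, h4⟩ := ih p0 (by omega) hp hp0
      exact ⟨a :: p, b, q, t ++ letterInv a :: q0, by simp, h2, h3, h4⟩
    · push Not at hp0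
      by_cases ha : P a.1
      · exact ⟨[], a, p0, q0, rfl, ha, hp0, hp⟩
      · have hq0 : ∃ l ∈ q0, P l.1 := by
          obtain ⟨l, hl, hPl⟩ := hP
          simp only [List.mem_cons, List.mem_append] at hl
          rcases hl with rfl | hl | rfl | hl
          · exact absurd hPl ha
          · exact absurd hPl (hp0 l hl)
          · exact absurd hPl ha
          · exact ⟨l, hl, hPl⟩
        obtain ⟨p, b, q, t, rfl, h2, h3, h4⟩ := ih q0 (by omega) hq hq0
        exact ⟨a :: (p0 ++ letterInv a :: p), b, q, t, by simp, h2, h3, h4⟩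

/-- An item of a word over `γ ⊕ β` part of which has been deleted: either a letter of `β`, or an
element of the free group on `γ` together with what is left of the word over `α` that expands
it. -/
abbrev Item (α β γ : Type*) := (β × Bool) ⊕ (FreeGroup γ × List (α × Bool))

/-- The word over `α` given by an item. -/
def Item.word (ι : β → α) : Item α β γ → List (α × Bool)
  | Sum.inl b => [(ι b.1, b.2)]
  | Sum.inr p => p.2

/-- The value of an item before any deletion. -/
def Item.val : Item α β γ → FreeGroup (γ ⊕ β)
  | Sum.inl b => rightLetter b
  | Sum.inr p => FreeGroup.map Sum.inl p.1

/-- The word over `α` given by a list of items. -/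
def itemsWord (ι : β → α) (I : List (Item α β γ)) : List (α × Bool) :=
  I.flatMap (Item.word ι)

/-- The value of a list of items. -/
def itemsVal (I : List (Item α β γ)) : FreeGroup (γ ⊕ β) := (I.map Item.val).prod

/-- No letter of a gap is the image of a letter in `β`. -/
def GapsAvoid (ι : β → α) (I : List (Item α β γ)) : Prop :=
  ∀ p : FreeGroup γ × List (α × Bool), Sum.inr p ∈ I → ∀ l ∈ p.2, l.1 ∉ Set.range ι

/-- Since gaps contain no images of `β`-letters, a split of the word at such a letter lifts to a
split of the list of items. -/
theorem exists_split_itemsWord {ι : β → α} {l : α × Bool} (hl : l.1 ∈ Set.range ι) :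
    ∀ (I : List (Item α β γ)) (p r : List (α × Bool)), GapsAvoid ι I →
      itemsWord ι I = p ++ l :: r →
      ∃ I₁ b I₂, I = I₁ ++ Sum.inl b :: I₂ ∧ itemsWord ι I₁ = p ∧ (ι b.1, b.2) = l ∧
        itemsWord ι I₂ = r := by
  intro I
  induction I with
  | nil =>
    intro p r _ h
    simp [itemsWord] at h
  | cons a I ih =>
    intro p r hg h
    have hg' : GapsAvoid ι I := fun p hp => hg p (List.mem_cons_of_mem _ hp)
    rcases a with b | ⟨v, g⟩
    · rcases p with _ | ⟨c, p⟩
      · simp only [itemsWord, List.flatMap_cons, Item.word, List.singleton_append,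
          List.nil_append, List.cons.injEq] at h
        exact ⟨[], b, I, rfl, rfl, h.1, h.2⟩
      · simp only [itemsWord, List.flatMap_cons, Item.word, List.cons_append,
          List.nil_append, List.cons.injEq] at h
        obtain ⟨I₁, b', I₂, rfl, h1, h2, h3⟩ := ih p r hg' h.2
        refine ⟨Sum.inl b :: I₁, b', I₂, rfl, ?_, h2, h3⟩
        rw [← h.1, ← h1]
        rfl
    · have h' : g ++ itemsWord ι I = p ++ l :: r := h
      rcases List.append_eq_append_iff.1 h' with ⟨as, rfl, h2⟩ | ⟨as, rfl, h2⟩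
      · obtain ⟨I₁, b', I₂, rfl, rfl, h2, h3⟩ := ih as r hg' h2
        exact ⟨Sum.inr (v, g) :: I₁, b', I₂, rfl, rfl, h2, h3⟩
      · rcases as with _ | ⟨c, as⟩
        · obtain ⟨I₁, b', I₂, rfl, h1, h2, h3⟩ := ih [] r hg' h2.symm
          refine ⟨Sum.inr (v, p ++ []) :: I₁, b', I₂, rfl, ?_, h2, h3⟩
          change p ++ [] ++ itemsWord ι I₁ = p
          rw [h1]
          simp
        · simp only [List.cons_append, List.cons.injEq] at h2
          obtain ⟨rfl, -⟩ := h2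
          exact absurd hl (hg (v, _) List.mem_cons_self _ (by simp))

/-- The expansion of a letter of `γ ⊕ β`, when the letters of `γ` stand for the words `rw`. -/
def expandLetter (ι : β → α) (rw : γ → List (α × Bool)) : (γ ⊕ β) × Bool → List (α × Bool)
  | (Sum.inl c, true) => rw c
  | (Sum.inl c, false) => FreeGroup.invRev (rw c)
  | (Sum.inr b, s) => [(ι b, s)]

theorem mk_flatMap_expandLetter (ι : β → α) (rw : γ → List (α × Bool))
    (w : List ((γ ⊕ β) × Bool)) :
    FreeGroup.mk (w.flatMap (expandLetter ι rw)) =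
      FreeGroup.lift (Sum.elim (fun c => FreeGroup.mk (rw c)) fun b => FreeGroup.of (ι b))
        (FreeGroup.mk w) := by
  induction w with
  | nil => simp
  | cons a w ih =>
    rw [List.flatMap_cons, mk_append, ih, mk_cons a w, _root_.map_mul]
    congr 1
    rcases a with ⟨c | b, _ | _⟩ <;> simp [expandLetter, FreeGroup.inv_mk, FreeGroup.of, FreeGroup.invRev]

variable [DecidableEq α]

/-- The number of letters that were deleted from an item, with `ρ` the expansion of gaps. -/
noncomputable def Item.cost (ρ : FreeGroup γ →* FreeGroup α) : Item α β γ → ℕ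
  | Sum.inl _ => 0
  | Sum.inr p => cancellationNorm (ρ p.1 * (FreeGroup.mk p.2)⁻¹)

theorem exists_gap_of_no_letter (ι : β → α) (ρ : FreeGroup γ →* FreeGroup α)
    (I : List (Item α β γ)) (hI : ∀ b, Sum.inl b ∉ I) :
    ∃ v, itemsVal I = FreeGroup.map Sum.inl v ∧
      cancellationNorm (ρ v * (FreeGroup.mk (itemsWord ι I))⁻¹) ≤
        (I.map (Item.cost ρ)).sum := by
  induction I with
  | nil =>
    refine ⟨1, by simp [itemsVal], ?_⟩
    have : FreeGroup.mk (itemsWord ι ([] : List (Item α β γ))) = 1 := rfl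
    simp [this]
  | cons a I ih =>
    obtain ⟨v, h1, h2⟩ := ih fun b hb => hI b (List.mem_cons_of_mem _ hb)
    rcases a with b | ⟨u, g⟩
    · exact absurd List.mem_cons_self (hI b)
    · refine ⟨u * v, ?_, ?_⟩
      · rw [_root_.map_mul, ← h1]
        rfl
      · have e : FreeGroup.mk (itemsWord ι (Sum.inr (u, g) :: I)) =
            FreeGroup.mk g * FreeGroup.mk (itemsWord ι I) := mk_append _ _
        have e' : ρ (u * v) * (FreeGroup.mk g * FreeGroup.mk (itemsWord ι I))⁻¹ =
            (ρ u * (ρ v * (FreeGroup.mk (itemsWord ι I))⁻¹) * (ρ u)⁻¹) *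
              (ρ u * (FreeGroup.mk g)⁻¹) := by
          rw [_root_.map_mul]
          group
        rw [e, e', List.map_cons, List.sum_cons, add_comm]
        exact (cancellationNorm_mul_le _ _).trans
          (Nat.add_le_add ((cancellationNorm_conj_le _ _).trans h2) le_rfl)

/-- Between an innermost matched pair of `β`-letters there are only gaps. They merge into one region
whose kept letters spell `1`, so its norm is at most the number of letters charged to those gaps.
Conjugating this region away lets the pair cancel, and the induction continues. -/
theorem exists_regionProd_of_itemsWord_eq_one {ι : β → α} (hι : Function.Injective ι)
    (ρ : FreeGroup γ →* FreeGroup α) (n : ℕ) : ∀ I : List (Item α β γ), I.length ≤ n →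
    GapsAvoid ι I → FreeGroup.mk (itemsWord ι I) = 1 →
    ∃ us, RegionProd 0 us (itemsVal I) ∧
      (us.map fun u => cancellationNorm (ρ u)).sum ≤ (I.map (Item.cost ρ)).sum := by
  induction n with
  | zero =>
    intro I hI _ _
    obtain rfl : I = [] := by simpa using hI
    exact ⟨[], RegionProd.one, by simp⟩
  | succ n ih =>
    intro I hI hg h1
    by_cases hb : ∃ b, Sum.inl b ∈ I
    · obtain ⟨b, hb⟩ := hb
      obtain ⟨p, b', q, t, e, hb', hq, hq1⟩ := exists_innermost_match (· ∈ Set.range ι) _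
        (itemsWord ι I) le_rfl h1
        ⟨(ι b.1, b.2), List.mem_flatMap.2 ⟨_, hb, by simp [Item.word]⟩, by simp⟩
      obtain ⟨I₁, c, J, rfl, rfl, rfl, hJ⟩ := exists_split_itemsWord hb' I _ _ hg e
      have hgJ : GapsAvoid ι J := fun p hp => hg p (by simp [hp])
      obtain ⟨I₂, d, I₃, rfl, rfl, hd, rfl⟩ := exists_split_itemsWord
        (l := letterInv (ι c.1, c.2)) (by simp [letterInv]) J _ _ hgJ hJ
      have hno : ∀ b, Sum.inl b ∉ I₂ := fun b hb =>
        hq (ι b.1, b.2) (List.mem_flatMap.2 ⟨_, hb, by simp [Item.word]⟩) (by simp)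
      obtain ⟨v, hv, hv'⟩ := exists_gap_of_no_letter ι ρ I₂ hno
      rw [hq1, inv_one, mul_one] at hv'
      have hdc : rightLetter (γ := γ) d = (rightLetter c)⁻¹ := by
        simp only [letterInv, Prod.mk.injEq] at hd
        obtain ⟨d1, d2⟩ := hd
        have : d = (c.1, !c.2) := Prod.ext (hι d1) d2
        rw [this, rightLetter, rightLetter, ← mk_letterInv]
        rfl
      obtain ⟨us, h2, h3⟩ := ih (I₁ ++ I₃) (by simp at hI ⊢; omega)
        (fun p hp => hg p (by
          rcases List.mem_append.1 hp with hp | hp <;> simp [hp]))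
        (by
          have e1 : itemsWord ι (I₁ ++ I₃) = itemsWord ι I₁ ++ itemsWord ι I₃ := by
            simp [itemsWord]
          rw [e, mk_append, mk_cons, mk_append, hq1, one_mul, mk_cons (letterInv _),
            mk_letterInv, mul_inv_cancel_left] at h1
          rw [e1, mk_append, h1])
      refine ⟨v :: us, ?_, ?_⟩
      · have e1 : itemsVal (I₁ ++ Sum.inl c :: (I₂ ++ Sum.inl d :: I₃)) =
            (itemsVal I₁ * rightLetter c) * FreeGroup.map Sum.inl v *
              (itemsVal I₁ * rightLetter c)⁻¹ * itemsVal (I₁ ++ I₃) := by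
          rw [← hv]
          simp only [itemsVal, List.map_append, List.map_cons, List.prod_append,
            List.prod_cons, Item.val, hdc]
          group
        rw [e1]
        exact RegionProd.region _ _ h2
      · simp only [List.map_append, List.map_cons, List.sum_append, List.sum_cons,
          Item.cost] at h3 ⊢
        omega
    · push Not at hb
      obtain ⟨v, hv, hv'⟩ := exists_gap_of_no_letter ι ρ I hb
      rw [h1, inv_one, mul_one] at hv'
      refine ⟨[v], ?_, by simpa using hv'⟩
      rw [hv]
      simpa using RegionProd.region v 1 (RegionProd.one (β := β))

theorem cancellationNorm_mul_inv_le_of_sublist {h w : List (α × Bool)} (hs : h.Sublist w) :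
    cancellationNorm (FreeGroup.mk w * (FreeGroup.mk h)⁻¹) + h.length ≤ w.length := by
  induction hs with
  | slnil => simp
  | @cons h w a _ ih =>
    rw [mk_cons, mul_assoc, List.length_cons]
    have h1 := cancellationNorm_mul_le (FreeGroup.mk [a]) (FreeGroup.mk w * (FreeGroup.mk h)⁻¹)
    have h2 := cancellationNorm_mk_singleton_le a
    omega
  | @cons_cons h w a _ ih =>
    have e : FreeGroup.mk (a :: w) * (FreeGroup.mk (a :: h))⁻¹ =
        FreeGroup.mk [a] * (FreeGroup.mk w * (FreeGroup.mk h)⁻¹) * (FreeGroup.mk [a])⁻¹ := by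
      rw [mk_cons, mk_cons a h]
      group
    rw [e, List.length_cons, List.length_cons]
    have := cancellationNorm_conj_le (FreeGroup.mk w * (FreeGroup.mk h)⁻¹) (FreeGroup.mk [a])
    omega

/-- Sorts the deletions by origin: a lost `β`-letter becomes a conjugate factor counted by `k`,
while a deletion inside the expansion of a `γ`-letter is charged to the cost of that gap. -/
theorem exists_items_of_sublist {ι : β → α} {rw : γ → List (α × Bool)}
    (hrw : ∀ c, ∀ l ∈ rw c, l.1 ∉ Set.range ι) (w : List ((γ ⊕ β) × Bool)) :
    ∀ s : List (α × Bool), s.Sublist (w.flatMap (expandLetter ι rw)) →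
      ∃ (I : List (Item α β γ)) (k : ℕ), GapsAvoid ι I ∧ itemsWord ι I = s ∧
        RegionProd k [] (FreeGroup.mk w * (itemsVal I)⁻¹) ∧
        k + (I.map (Item.cost (FreeGroup.lift fun c => FreeGroup.mk (rw c)))).sum + s.length ≤
          (w.flatMap (expandLetter ι rw)).length := by
  induction w with
  | nil =>
    intro s hs
    obtain rfl : s = [] := by simpa using hs
    refine ⟨[], 0, ?_, rfl, ?_, by simp⟩
    · intro p hp
      simp at hp
    · have : FreeGroup.mk ([] : List ((γ ⊕ β) × Bool)) * (itemsVal ([] : List (Item α β γ)))⁻¹ = 1 := by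
        simp [itemsVal]
      rw [this]
      exact RegionProd.one
  | cons a w ih =>
    intro s hs
    rw [List.flatMap_cons] at hs ⊢
    obtain ⟨s₁, s₂, rfl, h1, h2⟩ := List.sublist_append_iff.1 hs
    obtain ⟨I, k, hg, rfl, hD, hlen⟩ := ih s₂ h2
    have gap : ∀ c : γ, ∀ t : Bool, a = (Sum.inl c, t) →
        (∀ l ∈ expandLetter ι rw a, l.1 ∉ Set.range ι) →
        FreeGroup.mk (expandLetter ι rw a) =
          FreeGroup.lift (fun c => FreeGroup.mk (rw c)) (FreeGroup.mk [(c, t)]) →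
        ∃ (I' : List (Item α β γ)) (k : ℕ), GapsAvoid ι I' ∧
          itemsWord ι I' = s₁ ++ itemsWord ι I ∧
          RegionProd k [] (FreeGroup.mk (a :: w) * (itemsVal I')⁻¹) ∧
          k + (I'.map (Item.cost (FreeGroup.lift fun c => FreeGroup.mk (rw c)))).sum +
            (s₁ ++ itemsWord ι I).length ≤
              (expandLetter ι rw a ++ w.flatMap (expandLetter ι rw)).length := by
      rintro c t rfl hav hmk
      refine ⟨Sum.inr (FreeGroup.mk [(c, t)], s₁) :: I, k, ?_, rfl, ?_, ?_⟩
      · intro p hp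
        rcases List.mem_cons.1 hp with hp | hp
        · obtain rfl := Sum.inr_injective hp
          exact fun l hl => hav l (h1.subset hl)
        · exact hg p hp
      · have e : FreeGroup.mk ((Sum.inl c, t) :: w) *
            (itemsVal (Sum.inr (FreeGroup.mk [(c, t)], s₁) :: I))⁻¹ =
            FreeGroup.mk [(Sum.inl c, t)] * (FreeGroup.mk w * (itemsVal I)⁻¹) *
              (FreeGroup.mk [(Sum.inl c, t)])⁻¹ := by
          rw [mk_cons]
          simp only [itemsVal, List.map_cons, List.prod_cons, Item.val, FreeGroup.map.mk,
            List.map_nil, mul_inv_rev, mul_assoc]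
        rw [e]
        exact hD.conj _
      · simp only [List.map_cons, List.sum_cons, Item.cost, List.length_append]
        rw [← hmk]
        have := cancellationNorm_mul_inv_le_of_sublist h1
        omega
    rcases a with ⟨c | b, t⟩
    · cases t
      · refine gap c false rfl ?_ ?_
        · intro l hl
          simp only [expandLetter, FreeGroup.invRev, List.mem_reverse, List.mem_map] at hl
          obtain ⟨l', hl', rfl⟩ := hl
          exact hrw c l' hl'
        · simp [expandLetter, FreeGroup.inv_mk]
      · exact gap c true rfl (hrw c) (by simp [expandLetter])
    · have h1' : s₁.Sublist [(ι b, t)] := h1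
      have hl := h1'.length_le
      rcases s₁ with _ | ⟨l, s₁⟩
      · refine ⟨I, k + 1, hg, rfl, ?_, ?_⟩
        · rw [mk_cons, mul_assoc]
          simpa [rightLetter] using RegionProd.letter (b, t) 1 hD
        · simp [expandLetter] at hlen ⊢
          omega
      · obtain ⟨rfl, rfl⟩ : l = (ι b, t) ∧ s₁ = [] := by
          have := h1'.eq_of_length (by simp at hl ⊢; omega)
          simpa using this
        refine ⟨Sum.inl (b, t) :: I, k, ?_, rfl, ?_, ?_⟩
        · intro p hp
          rcases List.mem_cons.1 hp with hp | hp
          · cases hp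
          · exact hg p hp
        · have e : FreeGroup.mk ((Sum.inr b, t) :: w) *
              (itemsVal (Sum.inl (b, t) :: I : List (Item α β γ)))⁻¹ =
              rightLetter (b, t) * (FreeGroup.mk w * (itemsVal I)⁻¹) *
                (rightLetter (b, t))⁻¹ := by
            rw [mk_cons]
            simp only [itemsVal, List.map_cons, List.prod_cons, Item.val, mul_inv_rev,
              mul_assoc, rightLetter]
          rw [e]
          exact hD.conj _
        · simp [Item.cost, expandLetter] at hlen ⊢
          omega

/-- A factorization of the expansion of `g` into conjugates of letters splits `g` into regions. -/
theorem exists_regionProd {ι : β → α} (hι : Function.Injective ι) {rw : γ → List (α × Bool)}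
    (hrw : ∀ c, ∀ l ∈ rw c, l.1 ∉ Set.range ι) (g : FreeGroup (γ ⊕ β)) :
    ∃ s us, RegionProd s us g ∧
      s + (us.map fun u =>
          cancellationNorm (FreeGroup.lift (fun c => FreeGroup.mk (rw c)) u)).sum ≤
        cancellationNorm (FreeGroup.lift
          (Sum.elim (fun c => FreeGroup.mk (rw c)) fun b => FreeGroup.of (ι b)) g) := by
  obtain ⟨w, rfl⟩ := Quot.exists_rep g
  rw [FreeGroup.quot_mk_eq_mk, ← mk_flatMap_expandLetter]
  obtain ⟨s, h1, h2, h3⟩ := trivialUpTo_cancellationNorm (w.flatMap (expandLetter ι rw))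
  obtain ⟨I, k, hg, rfl, hD, hlen⟩ := exists_items_of_sublist hrw w s h1
  obtain ⟨us, h4, h5⟩ := exists_regionProd_of_itemsWord_eq_one hι
    (FreeGroup.lift fun c => FreeGroup.mk (rw c)) _ I le_rfl hg h2
  refine ⟨k + 0, [] ++ us, ?_, ?_⟩
  · have := hD.mul h4
    rwa [inv_mul_cancel_right] at this
  · simp only [add_zero, List.nil_append]
    omega

end Splitting

end CancellationNorm
namespace CancellationNorm

/-! ### Twisted elements and their nontriviality -/

section Twist

/-- The element `(x q y q)^m (y q x q)^{-m}`. -/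
def twist {G : Type*} [Group G] (m : ℕ) (x y q : G) : G :=
  (x * q * y * q) ^ m * ((y * q * x * q) ^ m)⁻¹

theorem map_twist {G H : Type*} [Group G] [Group H] (φ : G →* H) (m : ℕ) (x y q : G) :
    φ (twist m x y q) = twist m (φ x) (φ y) (φ q) := by
  simp [twist]

theorem twist_self {G : Type*} [Group G] (m : ℕ) (x q : G) : twist m x x q = 1 := by
  simp [twist]

theorem twist_of_comm {G : Type*} [CommGroup G] (m : ℕ) (x y q : G) : twist m x y q = 1 := by
  rw [twist, mul_inv_eq_one]
  congr 1
  rw [mul_right_comm x q y, mul_right_comm y q x, mul_comm x y]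

/-- Detected by affine maps of the rational line: with doubling `d` and unit shift `s`, the maps `(d
s)^m` and `(s d)^m` send `0` to different points. -/
theorem twist_of_ne_one {m : ℕ} (hm : m ≠ 0) {α : Type*} {a b : α} (hab : a ≠ b) :
    twist m (FreeGroup.of a) (FreeGroup.of b) 1 ≠ 1 := by
  classical
  intro h
  let d : Equiv.Perm ℚ := Units.mulLeft (Units.mk0 (2 : ℚ) two_ne_zero)
  let s : Equiv.Perm ℚ := Equiv.addRight (1 : ℚ)
  let φ : FreeGroup α →* Equiv.Perm ℚ := FreeGroup.lift fun c => if c = a then d else s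
  have ha : φ (FreeGroup.of a) = d := by simp [φ]
  have hb : φ (FreeGroup.of b) = s := by simp [φ, hab.symm]
  have h1 := congrArg φ h
  rw [map_twist, ha, hb, map_one, twist, mul_inv_eq_one] at h1
  simp only [mul_one] at h1
  have e1 : ∀ n : ℕ, ((d * s) ^ n) 0 = 2 * (2 ^ n - 1) := by
    intro n
    induction n with
    | zero => simp
    | succ n ih =>
      rw [pow_succ', Equiv.Perm.mul_apply, ih]
      simp only [d, s, Equiv.Perm.mul_apply, Equiv.coe_addRight, Units.mulLeft_apply,
        Units.val_mk0]
      ring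
  have e2 : ∀ n : ℕ, ((s * d) ^ n) 0 = 2 ^ n - 1 := by
    intro n
    induction n with
    | zero => simp
    | succ n ih =>
      rw [pow_succ', Equiv.Perm.mul_apply, ih]
      simp only [d, s, Equiv.Perm.mul_apply, Equiv.coe_addRight, Units.mulLeft_apply,
        Units.val_mk0]
      ring
  have h2 := congrArg (fun p : Equiv.Perm ℚ => p 0) h1
  simp only [e1, e2] at h2
  have h3 : (1 : ℚ) < 2 ^ m := one_lt_pow₀ (by norm_num) hm
  linarith

end Twist

/-! ### The cost of one level -/

section Step

variable {γ : Type*}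

/-- The letter `x` (for `true`) or `y` (for `false`). -/
def bit (b : Bool) : FreeGroup (γ ⊕ Bool) := FreeGroup.of (Sum.inr b)

/-- The twisted element with gaps `q`. -/
def block (m : ℕ) (q : FreeGroup γ) : FreeGroup (γ ⊕ Bool) :=
  twist m (bit true) (bit false) (FreeGroup.map Sum.inl q)

/-- The substitution that puts the conjugate of a twisted element by `h` before each generator `g`
with `t g = some h`. -/
def insertBlock (m : ℕ) (t : γ → Option (FreeGroup γ)) (q : FreeGroup γ) :
    FreeGroup γ →* FreeGroup (γ ⊕ Bool) :=
  FreeGroup.lift fun g => match t g with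
    | none => FreeGroup.of (Sum.inl g)
    | some h => FreeGroup.map Sum.inl h * block m q * (FreeGroup.map Sum.inl h)⁻¹ *
        FreeGroup.of (Sum.inl g)

/-- The exponent sum of the generators before which a twisted element is inserted. -/
def blockCount (t : γ → Option (FreeGroup γ)) : FreeGroup γ →* Multiplicative ℤ :=
  FreeGroup.lift fun g => if (t g).isSome then Multiplicative.ofAdd 1 else 1

theorem RegionProd.map_eq {A : Type*} [CommGroup A] {s : ℕ} {us : List (FreeGroup γ)}
    {g : FreeGroup (γ ⊕ Bool)} (h : RegionProd s us g) (θ : FreeGroup γ →* A) :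
    FreeGroup.lift (Sum.elim (fun c => θ (FreeGroup.of c)) fun _ => 1) g = (us.map θ).prod := by
  induction h with
  | one => simp
  | letter b c _ ih =>
    rw [map_mul, ih, map_mul, map_inv, map_mul, mul_inv_cancel_comm]
    rcases b with ⟨b, _ | _⟩ <;> simp [rightLetter]
  | region v c _ ih =>
    rw [map_mul, ih, map_mul, map_inv, map_mul, mul_inv_cancel_comm,
      List.map_cons, List.prod_cons]
    congr 1
    have : (FreeGroup.lift (Sum.elim (fun c => θ (FreeGroup.of c)) fun _ => 1)).comp
        (FreeGroup.map (Sum.inl : γ → γ ⊕ Bool)) = θ := by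
      ext; simp
    exact DFunLike.congr_fun this v

/-- Abelian invariants pass to the regions: conjugations and inserted blocks disappear in a
commutative group once the letters `x`, `y` are killed. -/
theorem RegionProd.prod_map_eq {A : Type*} [CommGroup A] {m s : ℕ} {us : List (FreeGroup γ)}
    {t : γ → Option (FreeGroup γ)} {q v : FreeGroup γ}
    (h : RegionProd s us (insertBlock m t q v)) (θ : FreeGroup γ →* A) :
    (us.map θ).prod = θ v := by
  rw [← h.map_eq θ]
  have : (FreeGroup.lift (Sum.elim (fun c => θ (FreeGroup.of c)) fun _ => 1)).comp
      (insertBlock m t q) = θ := by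
    ext g
    simp only [insertBlock, MonoidHom.coe_comp, Function.comp_apply, FreeGroup.lift_apply_of]
    rcases t g with _ | h
    · simp
    · simp only [map_mul, block, map_twist, twist_of_comm]
      simp
  exact DFunLike.congr_fun this v

/-- Killing the symbols of `γ` leaves a nonzero power of a twisted element, so some letter is lost;
the parity of the number of letters excludes losing exactly one. -/
theorem RegionProd.two_le {m s : ℕ} (hm : m ≠ 0) {us : List (FreeGroup γ)}
    {t : γ → Option (FreeGroup γ)} {q v : FreeGroup γ}
    (h : RegionProd s us (insertBlock m t q v)) (hv : blockCount t v ≠ 1) : 2 ≤ s := by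
  set κ : FreeGroup (γ ⊕ Bool) →* FreeGroup Bool :=
    FreeGroup.lift (Sum.elim (fun _ => 1) FreeGroup.of) with hκ
  set T : FreeGroup Bool := twist m (FreeGroup.of true) (FreeGroup.of false) 1 with hT
  have hinl : ∀ u : FreeGroup γ, κ (FreeGroup.map Sum.inl u) = 1 := by
    intro u
    have : κ.comp (FreeGroup.map Sum.inl) = 1 := by ext; simp [hκ]
    exact DFunLike.congr_fun this u
  have h1 : κ (insertBlock m t q v) = T ^ (Multiplicative.toAdd (blockCount t v)) := by
    have : κ.comp (insertBlock m t q) = (zpowersHom _ T).comp (blockCount t) := by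
      ext g
      simp only [insertBlock, blockCount, MonoidHom.coe_comp, Function.comp_apply,
        FreeGroup.lift_apply_of]
      rcases t g with _ | h
      · simp [hκ]
      · simp only [map_mul, block, map_twist, hinl, map_inv, inv_one, one_mul, mul_one]
        simp [hκ, bit, hT, zpowersHom_apply]
    have := DFunLike.congr_fun this v
    simpa [zpowersHom_apply] using this
  have hne : κ (insertBlock m t q v) ≠ 1 := by
    rw [h1]
    intro h0
    have hz : Multiplicative.toAdd (blockCount t v) ≠ 0 := fun e => hv (by
      rw [← ofAdd_toAdd (blockCount t v), e, ofAdd_zero])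
    exact twist_of_ne_one hm (by simp) ((IsMulTorsionFree.zpow_eq_one_iff_left hz).1 h0)
  -- Counts the letters `x`, `y` modulo 2. Blocks have even count, since twisted elements vanish in
  -- commutative groups.
  set par : FreeGroup (γ ⊕ Bool) →* Multiplicative (ZMod 2) :=
    FreeGroup.lift (Sum.elim (fun _ => 1) fun _ => Multiplicative.ofAdd 1) with hpar
  have hpar1 : par (insertBlock m t q v) = 1 := by
    have : par.comp (insertBlock m t q) = 1 := by
      ext g
      simp only [insertBlock, MonoidHom.coe_comp, Function.comp_apply, FreeGroup.lift_apply_of]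
      rcases t g with _ | h
      · simp [hpar]
      · simp only [map_mul, block, map_twist, twist_of_comm]
        simp [hpar]
    exact DFunLike.congr_fun this v
  have key : ∀ {s : ℕ} {us : List (FreeGroup γ)} {g : FreeGroup (γ ⊕ Bool)},
      RegionProd s us g → par g = Multiplicative.ofAdd (s : ZMod 2) ∧ (s = 0 → κ g = 1) := by
    intro s us g h
    induction h with
    | one => simp
    | letter b c _ ih =>
      refine ⟨?_, by simp⟩
      have : par (rightLetter b) = Multiplicative.ofAdd 1 := by
        rcases b with ⟨b, _ | _⟩
        · simp [rightLetter, hpar]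
          rfl
        · simp [rightLetter, hpar]
      rw [map_mul, ih.1, map_mul, map_inv, map_mul, mul_inv_cancel_comm, this,
        ← ofAdd_add]
      push_cast
      rw [add_comm]
    | region u c _ ih =>
      have : par (FreeGroup.map Sum.inl u) = 1 := by
        have : par.comp (FreeGroup.map Sum.inl) = 1 := by ext; simp [hpar]
        exact DFunLike.congr_fun this u
      refine ⟨?_, fun hs => ?_⟩
      · rw [map_mul, ih.1, map_mul, map_inv, map_mul, this]
        simp
      · rw [map_mul, ih.2 hs, map_mul, map_inv, map_mul, hinl]
        simp
  obtain ⟨k1, k2⟩ := key h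
  have hs0 : s ≠ 0 := fun hs => hne (k2 hs)
  have hs2 : (s : ZMod 2) = 0 := by
    rw [hpar1] at k1
    exact (Multiplicative.ofAdd.injective k1).symm
  rw [ZMod.natCast_eq_zero_iff] at hs2
  omega


theorem one_le_norm_toComplex {z : GaussianInt} (hz : z ≠ 0) :
    1 ≤ ‖GaussianInt.toComplex z‖ := by
  have h1 : (1 : ℤ) ≤ z.norm := GaussianInt.norm_pos.2 hz
  have h2 : (1 : ℝ) ≤ Complex.normSq (GaussianInt.toComplex z) := by
    rw [← GaussianInt.intCast_real_norm]
    exact_mod_cast h1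
  rw [Complex.normSq_eq_norm_sq] at h2
  nlinarith [norm_nonneg (GaussianInt.toComplex z)]

theorem norm_toComplex_unit (u : GaussianIntˣ) :
    ‖GaussianInt.toComplex (u : GaussianInt)‖ = 1 := by
  have h1 := one_le_norm_toComplex u.ne_zero
  have h2 := one_le_norm_toComplex (u⁻¹).ne_zero
  have h3 : ‖GaussianInt.toComplex (u : GaussianInt)‖ *
      ‖GaussianInt.toComplex ((u⁻¹ : GaussianIntˣ) : GaussianInt)‖ = 1 := by
    rw [← norm_mul, ← map_mul, Units.mul_inv]
    simp
  nlinarith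

/-- The reduction of Gaussian integers modulo `1 + i`. -/
def gaussParity : GaussianInt →+* ZMod 2 := Zsqrtd.lift ⟨1, by decide⟩

theorem gaussParity_unit (u : GaussianIntˣ) : gaussParity u = 1 := by
  have h : IsUnit (gaussParity (u : GaussianInt)) := u.isUnit.map gaussParity
  have h2 : ∀ z : ZMod 2, IsUnit z → z = 1 := by decide
  exact h2 _ h

/-- The affine action on the Gaussian integers in which the generators of `γ` act by
multiplication through `χ`, the letter `x` by translation and the letter `y` trivially. -/
def affineAct (χ : FreeGroup γ →* GaussianIntˣ) :
    FreeGroup (γ ⊕ Bool) →* Equiv.Perm GaussianInt :=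
  FreeGroup.lift (Sum.elim (fun g => Units.mulLeft (χ (FreeGroup.of g)))
    fun b => if b then Equiv.addRight 1 else 1)

variable (χ : FreeGroup γ →* GaussianIntˣ)

theorem affineAct_map_inl (v : FreeGroup γ) :
    affineAct χ (FreeGroup.map Sum.inl v) = Units.mulLeft (χ v) := by
  have : (affineAct χ).comp (FreeGroup.map Sum.inl) =
      (MulAction.toPermHom GaussianIntˣ GaussianInt).comp χ := by
    ext g : 1
    ext z : 1
    simp [affineAct, Units.smul_def]
  rw [show affineAct χ (FreeGroup.map Sum.inl v) = _ from DFunLike.congr_fun this v]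
  ext z : 1
  simp [Units.smul_def]

theorem exists_affineAct_add (g : FreeGroup (γ ⊕ Bool)) :
    ∃ u : GaussianIntˣ, ∀ z τ : GaussianInt,
      affineAct χ g (z + τ) = affineAct χ g z + u * τ := by
  induction g using FreeGroup.induction_on with
  | C1 => exact ⟨1, by simp⟩
  | of a =>
    rcases a with g | _ | _
    · exact ⟨χ (FreeGroup.of g), by simp [affineAct, mul_add]⟩
    · exact ⟨1, by simp [affineAct]⟩
    · exact ⟨1, by simp [affineAct, add_right_comm]⟩
  | inv_of a ih =>
    obtain ⟨u, hu⟩ := ih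
    refine ⟨u⁻¹, fun z τ => ?_⟩
    rw [map_inv, Equiv.Perm.inv_eq_iff_eq, hu]
    simp
  | mul g h ihg ihh =>
    obtain ⟨u, hu⟩ := ihg
    obtain ⟨v, hv⟩ := ihh
    refine ⟨u * v, fun z τ => ?_⟩
    rw [map_mul, Equiv.Perm.mul_apply, Equiv.Perm.mul_apply, hv, hu]
    push_cast
    ring

theorem affineAct_conj_eq_add {g c : FreeGroup (γ ⊕ Bool)} {τ : GaussianInt}
    (h : ∀ z, affineAct χ g z = z + τ) :
    ∃ u : GaussianIntˣ, ∀ z, affineAct χ (c * g * c⁻¹) z = z + u * τ := by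
  obtain ⟨u, hu⟩ := exists_affineAct_add χ c
  refine ⟨u, fun z => ?_⟩
  rw [map_mul, map_mul, map_inv, Equiv.Perm.mul_apply, Equiv.Perm.mul_apply, h, hu]
  simp

/-- Regions killed by `χ` act trivially and a conjugated letter is a translation by a unit or by
`0`, so the triangle inequality bounds the total translation by `s`. -/
theorem RegionProd.exists_translation {s : ℕ} {us : List (FreeGroup γ)}
    {g : FreeGroup (γ ⊕ Bool)} (h : RegionProd s us g) (hus : ∀ u ∈ us, χ u = 1) :
    ∃ τ : GaussianInt, (∀ z, affineAct χ g z = z + τ) ∧ ‖GaussianInt.toComplex τ‖ ≤ s := by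
  induction h with
  | one => exact ⟨0, by simp, by simp⟩
  | @letter b c s us g _ ih =>
    obtain ⟨τ, h1, h2⟩ := ih hus
    obtain ⟨σ, h3, h4⟩ : ∃ σ : GaussianInt, (∀ z, affineAct χ (rightLetter b) z = z + σ) ∧
        ‖GaussianInt.toComplex σ‖ ≤ 1 := by
      rcases b with ⟨_ | _, _ | _⟩
      · exact ⟨0, by simp [rightLetter, affineAct], by simp⟩
      · exact ⟨0, by simp [rightLetter, affineAct], by simp⟩
      · refine ⟨-1, fun z => ?_, by simp⟩
        simp [rightLetter, affineAct, Equiv.Perm.inv_def]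
      · exact ⟨1, by simp [rightLetter, affineAct], by simp⟩
    obtain ⟨u, h5⟩ := affineAct_conj_eq_add χ (c := c) h3
    refine ⟨τ + u * σ, fun z => ?_, ?_⟩
    · rw [map_mul, Equiv.Perm.mul_apply, h1, h5, add_assoc]
    · have := norm_add_le (GaussianInt.toComplex τ) (GaussianInt.toComplex (u * σ))
      rw [map_add]
      rw [map_mul, norm_mul, norm_toComplex_unit, one_mul] at this
      rw [map_mul] 
      push_cast
      linarith
  | @region v c s us g _ ih =>
    obtain ⟨τ, h1, h2⟩ := ih fun u hu => hus u (List.mem_cons_of_mem _ hu)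
    refine ⟨τ, fun z => ?_, h2⟩
    have : affineAct χ (FreeGroup.map Sum.inl v) = 1 := by
      rw [affineAct_map_inl, hus v List.mem_cons_self]
      ext z : 1
      simp
    rw [map_mul, map_mul, map_mul, this, map_inv]
    simp [h1]

/-- As `q` reflects, `x q y q` shifts by `1` and `y q x q` by `-1`; the two powers therefore add up
instead of cancelling. -/
theorem affineAct_block (m : ℕ) {q : FreeGroup γ} (hq : χ q = -1) (z : GaussianInt) :
    affineAct χ (block m q) z = z + 2 * m := by
  rw [block, map_twist, affineAct_map_inl, hq]
  have hx : ∀ z, affineAct χ (bit true) z = z + 1 := by simp [bit, affineAct]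
  have hy : ∀ z, affineAct χ (bit false) z = z := by simp [bit, affineAct]
  have hm : ∀ z, (Units.mulLeft (-1 : GaussianIntˣ)) z = -z := by simp
  generalize affineAct χ (bit true) = X at hx
  generalize affineAct χ (bit false) = Y at hy
  generalize Units.mulLeft (-1 : GaussianIntˣ) = Q at hm
  have h1 : ∀ n : ℕ, ∀ z, ((X * Q * Y * Q) ^ n) z = z + n := by
    intro n
    induction n with
    | zero => simp
    | succ n ih =>
      intro z
      rw [pow_succ, Equiv.Perm.mul_apply, ih]
      simp only [Equiv.Perm.mul_apply, hx, hy, hm]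
      push_cast
      ring
  have h2 : ∀ n : ℕ, ∀ z, ((Y * Q * X * Q) ^ n) z = z - n := by
    intro n
    induction n with
    | zero => simp
    | succ n ih =>
      intro z
      rw [pow_succ, Equiv.Perm.mul_apply, ih]
      simp only [Equiv.Perm.mul_apply, hx, hy, hm]
      push_cast
      ring
  have h3 : (((Y * Q * X * Q) ^ m)⁻¹) z = z + m := by
    rw [Equiv.Perm.inv_eq_iff_eq, h2]
    ring
  rw [twist, Equiv.Perm.mul_apply, h3, h1]
  ring

/-- Each conjugated block shifts by `2m` times a unit, and units are odd modulo `1 + i`, so `c` has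
the parity of the signed number of blocks. -/
theorem exists_affineAct_insertBlock (m : ℕ) (t : γ → Option (FreeGroup γ)) {q : FreeGroup γ}
    (hq : χ q = -1) (v : FreeGroup γ) :
    ∃ c : GaussianInt, (∀ z, affineAct χ (insertBlock m t q v) z = χ v * z + 2 * m * c) ∧
      gaussParity c = (Multiplicative.toAdd (blockCount t v) : ℤ) := by
  induction v using FreeGroup.induction_on with
  | C1 => exact ⟨0, by simp, by simp⟩
  | of g =>
    rcases h : t g with _ | p
    · refine ⟨0, fun z => ?_, by simp [blockCount, h]⟩
      simp [insertBlock, h, affineAct]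
    · refine ⟨χ p, fun z => ?_, by simp [blockCount, h, gaussParity_unit]⟩
      have hp : ∀ w, affineAct χ (FreeGroup.map Sum.inl p * block m q *
          (FreeGroup.map Sum.inl p)⁻¹) w = w + 2 * m * χ p := by
        intro w
        rw [map_mul (affineAct χ), map_mul (affineAct χ), map_inv (affineAct χ), Equiv.Perm.mul_apply, Equiv.Perm.mul_apply,
          affineAct_block χ m hq, affineAct_map_inl]
        have : ∀ w, (Units.mulLeft (χ p))⁻¹ w = ((χ p)⁻¹ : GaussianIntˣ) * w := by
          intro w
          rw [Equiv.Perm.inv_eq_iff_eq]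
          simp
        rw [this]
        simp only [Units.mulLeft_apply, mul_add, Units.mul_inv_cancel_left]
        ring
      have e : insertBlock m t q (FreeGroup.of g) = FreeGroup.map Sum.inl p * block m q *
          (FreeGroup.map Sum.inl p)⁻¹ * FreeGroup.of (Sum.inl g) := by
        simp [insertBlock, h]
      rw [e, map_mul (affineAct χ), Equiv.Perm.mul_apply, hp]
      simp [affineAct]
  | inv_of g ih =>
    obtain ⟨c, h1, h2⟩ := ih
    refine ⟨-((χ (FreeGroup.of g))⁻¹ : GaussianIntˣ) * c, fun z => ?_, ?_⟩
    · rw [map_inv, map_inv, Equiv.Perm.inv_eq_iff_eq, h1, map_inv, mul_add,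
        Units.mul_inv_cancel_left]
      have := Units.mul_inv (χ (FreeGroup.of g))
      linear_combination (2 * m * c) * this
    · rw [map_mul, map_neg, gaussParity_unit, h2, map_inv]
      simp
  | mul v w ihv ihw =>
    obtain ⟨c, h1, h2⟩ := ihv
    obtain ⟨d, h3, h4⟩ := ihw
    refine ⟨c + χ v * d, fun z => ?_, ?_⟩
    · rw [map_mul, map_mul, Equiv.Perm.mul_apply, h3, h1, map_mul]
      push_cast
      ring
    · rw [map_add, map_mul, gaussParity_unit, h2, h4, map_mul, toAdd_mul]
      push_cast
      ring

/-- Either many letters are lost, or some region is seen by `χ`. -/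
theorem RegionProd.two_mul_le_or {m s : ℕ} {us : List (FreeGroup γ)}
    {t : γ → Option (FreeGroup γ)} {q v : FreeGroup γ}
    (h : RegionProd s us (insertBlock m t q v)) (hq : χ q = -1) (hv : χ v = 1)
    (hodd : ((Multiplicative.toAdd (blockCount t v) : ℤ) : ZMod 2) ≠ 0) :
    2 * m ≤ s ∨ ∃ u ∈ us, χ u ≠ 1 := by
  by_contra! hcon
  obtain ⟨hs, hus⟩ := hcon
  obtain ⟨τ, h1, h2⟩ := h.exists_translation χ hus
  obtain ⟨c, h3, h4⟩ := exists_affineAct_insertBlock χ m t hq v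
  have e : τ = 2 * m * c := by
    have := h1 0
    rw [h3, hv] at this
    simpa using this.symm
  -- An odd number of blocks cannot cancel completely, and a nonzero Gaussian integer has modulus at
  -- least `1`; hence the translation `2 m c` has length at least `2m`.
  have hc : c ≠ 0 := by
    rintro rfl
    rw [map_zero] at h4
    exact hodd h4.symm
  have h5 := one_le_norm_toComplex hc
  rw [e, map_mul, norm_mul] at h2
  have h6 : ‖GaussianInt.toComplex (2 * m)‖ = 2 * m := by
    rw [map_mul, norm_mul, map_natCast, Complex.norm_natCast, map_ofNat, Complex.norm_ofNat]
  rw [h6] at h2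
  have h7 : (s : ℝ) < 2 * m := by exact_mod_cast hs
  nlinarith [norm_nonneg (GaussianInt.toComplex c)]

end Step

end CancellationNorm
namespace CancellationNorm

/-! ### Recursive form of the iterated substitution -/

section Expansion

/-- The symbols for the three products of twisted elements that occur between letters: over all
later indices (`r`), over the even ones (`e`) and over the odd ones (`o`). -/
inductive Sym : Type
  | r
  | e
  | o

/-- The letter `x_i` (for `true`) or `y_i` (for `false`). -/
def genOf (i : ℕ) (b : Bool) : Gen := if b then Gen.x i else Gen.y i

/-- Where twisted elements of odd index are inserted. -/
def insOdd : Sym → Option (FreeGroup Sym)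
  | Sym.r => some (FreeGroup.of Sym.r * (FreeGroup.of Sym.o)⁻¹)
  | Sym.e => none
  | Sym.o => some 1

/-- Where twisted elements of even index are inserted. -/
def insEven : Sym → Option (FreeGroup Sym)
  | Sym.r => some (FreeGroup.of Sym.r)
  | Sym.e => some (FreeGroup.of Sym.e)
  | Sym.o => none

/-- The substitution of level `j`. -/
def insertLevel (m j : ℕ) : FreeGroup Sym →* FreeGroup (Sym ⊕ Bool) :=
  if Odd j then insertBlock m insOdd (FreeGroup.of Sym.e * (FreeGroup.of Sym.o)⁻¹)
  else insertBlock m insEven (FreeGroup.of Sym.r)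

/-- The values of the symbols above level `j`, when there are `n` further levels. -/
def gapHom (m : ℕ) : ℕ → ℕ → (FreeGroup Sym →* F)
  | 0, _ => 1
  | n + 1, j => (FreeGroup.lift (Sum.elim (fun c => gapHom m n (j + 1) (FreeGroup.of c))
      fun b => FreeGroup.of (genOf (j + 1) b))).comp (insertLevel m (j + 1))

/-- The product over all later indices. -/
def gapR (m n j : ℕ) : F := gapHom m n j (FreeGroup.of Sym.r)

/-- The product over the later even indices. -/
def gapE (m n j : ℕ) : F := gapHom m n j (FreeGroup.of Sym.e)

/-- The product over the later odd indices. -/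
def gapO (m n j : ℕ) : F := gapHom m n j (FreeGroup.of Sym.o)

theorem lift_gapHom_map_inl (m n j i : ℕ) (v : FreeGroup Sym) :
    FreeGroup.lift (Sum.elim (fun c => gapHom m n j (FreeGroup.of c))
      fun b => FreeGroup.of (genOf i b)) (FreeGroup.map Sum.inl v) = gapHom m n j v := by
  have : (FreeGroup.lift (Sum.elim (fun c => gapHom m n j (FreeGroup.of c))
      fun b => FreeGroup.of (genOf i b))).comp (FreeGroup.map Sum.inl) = gapHom m n j := by
    ext; simp
  exact DFunLike.congr_fun this v

theorem lift_gapHom_block (m n j i : ℕ) (q : FreeGroup Sym) :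
    FreeGroup.lift (Sum.elim (fun c => gapHom m n j (FreeGroup.of c))
      fun b => FreeGroup.of (genOf i b)) (block m q) = twist m (x i) (y i) (gapHom m n j q) := by
  rw [block, map_twist, lift_gapHom_map_inl]
  simp [bit, genOf, x, y]

section Recursion

variable {m n j : ℕ}

@[simp]
theorem gapR_zero : gapR m 0 j = 1 := rfl

@[simp]
theorem gapE_zero : gapE m 0 j = 1 := rfl

@[simp]
theorem gapO_zero : gapO m 0 j = 1 := rfl

/-- The twisted element of even index `j + 1`, after all later substitutions. -/
def twistEven (m n j : ℕ) : F := twist m (x (j + 1)) (y (j + 1)) (gapR m n (j + 1))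

/-- The twisted element of odd index `j + 1`, after all later substitutions. -/
def twistOdd (m n j : ℕ) : F :=
  (gapO m n (j + 1))⁻¹ *
    twist m (x (j + 1)) (y (j + 1)) (gapE m n (j + 1) * (gapO m n (j + 1))⁻¹) *
    gapO m n (j + 1)

theorem gapR_succ_odd (h : Odd (j + 1)) :
    gapR m (n + 1) j = gapR m n (j + 1) * twistOdd m n j := by
  simp only [gapR, gapHom, insertLevel, if_pos h, insertBlock, MonoidHom.comp_apply,
    FreeGroup.lift_apply_of, insOdd, map_mul, map_inv, lift_gapHom_map_inl, lift_gapHom_block,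
    Sum.elim_inl, twistOdd, gapE, gapO]
  group

theorem gapE_succ_odd (h : Odd (j + 1)) : gapE m (n + 1) j = gapE m n (j + 1) := by
  simp [gapE, gapHom, insertLevel, if_pos h, insertBlock, insOdd]

theorem gapO_succ_odd (h : Odd (j + 1)) :
    gapO m (n + 1) j = gapO m n (j + 1) * twistOdd m n j := by
  simp only [gapHom, insertLevel, if_pos h, insertBlock, MonoidHom.comp_apply,
    FreeGroup.lift_apply_of, insOdd, map_mul, map_inv, lift_gapHom_block,
    Sum.elim_inl, twistOdd, gapE, gapO, map_one]
  group

theorem gapR_succ_even (h : ¬ Odd (j + 1)) :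
    gapR m (n + 1) j = gapR m n (j + 1) * twistEven m n j := by
  simp only [gapR, gapHom, insertLevel, if_neg h, insertBlock, MonoidHom.comp_apply,
    FreeGroup.lift_apply_of, insEven, map_mul, map_inv, lift_gapHom_map_inl, lift_gapHom_block,
    Sum.elim_inl, twistEven]
  group

theorem gapE_succ_even (h : ¬ Odd (j + 1)) :
    gapE m (n + 1) j = gapE m n (j + 1) * twistEven m n j := by
  simp only [gapR, gapE, gapHom, insertLevel, if_neg h, insertBlock, MonoidHom.comp_apply,
    FreeGroup.lift_apply_of, insEven, map_mul, map_inv, lift_gapHom_map_inl, lift_gapHom_block,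
    Sum.elim_inl, twistEven]
  group

theorem gapO_succ_even (h : ¬ Odd (j + 1)) : gapO m (n + 1) j = gapO m n (j + 1) := by
  simp [gapO, gapHom, insertLevel, if_neg h, insertBlock, insEven]

end Recursion

theorem twist_mul_right {G : Type*} [Group G] (m : ℕ) (x y q : G) :
    twist m (x * q) (y * q) 1 = twist m x y q := by
  simp [twist, mul_assoc]

/-- Odd generators get `o⁻¹` on the left and `e` on the right; conjugating by `o` gathers these into
the single gap `e o⁻¹`. -/
theorem twist_inv_mul_mul {G : Type*} [Group G] (m : ℕ) (x y e o : G) :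
    twist m (o⁻¹ * x * e) (o⁻¹ * y * e) 1 = o⁻¹ * twist m x y (e * o⁻¹) * o := by
  have h := map_twist (MulAut.conj o⁻¹).toMonoidHom m x y (e * o⁻¹)
  simp only [MulEquiv.toMonoidHom_eq_coe, MonoidHom.coe_coe, MulAut.conj_apply, inv_inv] at h
  rw [h, ← twist_mul_right m (o⁻¹ * x * o)]
  congr 1 <;> group

theorem T_eq_twist (m i : ℕ) : T m i = twist m (x i) (y i) 1 := by
  simp [T, twist]

theorem fComp_succ' (m j n : ℕ) : fComp m j (n + 1) = (fComp m (j + 1) n).comp (f m (j + 1)) := by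
  induction n with
  | zero => rfl
  | succ n ih =>
    rw [fComp, ih, fComp, ← MonoidHom.comp_assoc]
    congr 3
    omega

/-- Peels off the map applied first. The hypothesis for `x_{j+1}` and `y_{j+1}` computes the image
of `T_{j+1}` under the remaining maps, which is the next factor of the gap. -/
theorem fComp_of (m n : ℕ) : ∀ (j : ℕ) (a : Gen), a.index ≤ j →
    fComp m j n (FreeGroup.of a) = if Odd a.index
      then (gapO m n j)⁻¹ * FreeGroup.of a * gapE m n j else FreeGroup.of a * gapR m n j := by
  induction n with
  | zero =>
    intro j a _
    simp [fComp]
  | succ n ih =>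
    intro j a ha
    have hT : fComp m (j + 1) n (T m (j + 1)) =
        if Odd (j + 1) then twistOdd m n j else twistEven m n j := by
      have hx := ih (j + 1) (Gen.x (j + 1)) le_rfl
      have hy := ih (j + 1) (Gen.y (j + 1)) le_rfl
      rw [T_eq_twist, map_twist, map_one, x, y, hx, hy]
      by_cases h : Odd (j + 1)
      · have hx' : Odd (Gen.x (j + 1)).index := h
        have hy' : Odd (Gen.y (j + 1)).index := h
        rw [if_pos h, if_pos hx', if_pos hy', twist_inv_mul_mul]
        rfl
      · have hx' : ¬ Odd (Gen.x (j + 1)).index := h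
        have hy' : ¬ Odd (Gen.y (j + 1)).index := h
        rw [if_neg h, if_neg hx', if_neg hy', twist_mul_right]
        rfl
    have hf : f m (j + 1) (FreeGroup.of a) = if Odd a.index ∧ Odd (j + 1)
        then (T m (j + 1))⁻¹ * FreeGroup.of a else FreeGroup.of a * T m (j + 1) := by
      simp [f]
    rw [fComp_succ', MonoidHom.comp_apply, hf]
    by_cases h1 : Odd a.index <;> by_cases h2 : Odd (j + 1)
    · simp only [h1, h2, and_self, if_true, map_mul, map_inv, hT, ih (j + 1) a (by omega),
        gapO_succ_odd h2, gapE_succ_odd h2]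
      group
    · simp only [h1, h2, and_false, if_true, if_false, map_mul, hT,
        ih (j + 1) a (by omega), gapO_succ_even h2, gapE_succ_even h2]
      group
    · simp only [h1, h2, false_and, if_true, if_false, map_mul, hT,
        ih (j + 1) a (by omega), gapR_succ_odd h2]
      group
    · simp only [h1, h2, false_and, if_false, map_mul, hT,
        ih (j + 1) a (by omega), gapR_succ_even h2]
      group

theorem wBar_eq (m : ℕ) : wBar m = x 0 * gapR m (2 * m - 2) 2 := by
  rw [wBar, fUp, x, fComp_of m _ 2 (Gen.x 0) (by simp [Gen.index])]
  simp [Gen.index]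

end Expansion

/-! ### Separation of the alphabet by levels -/

section Levels

/-- The subgroup of the elements that only involve letters of index more than `j`. -/
def above (j : ℕ) : Subgroup F := Subgroup.closure {g | ∃ a : Gen, j < a.index ∧ FreeGroup.of a = g}

theorem of_mem_above {j : ℕ} {a : Gen} (h : j < a.index) : FreeGroup.of a ∈ above j :=
  Subgroup.subset_closure ⟨a, h, rfl⟩

theorem above_antitone {j k : ℕ} (h : j ≤ k) : above k ≤ above j :=
  Subgroup.closure_mono fun _ ⟨a, ha, e⟩ => ⟨a, by omega, e⟩

theorem exists_word_of_mem_above {j : ℕ} {g : F} (h : g ∈ above j) :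
    ∃ w : List (Gen × Bool), FreeGroup.mk w = g ∧ ∀ l ∈ w, j < l.1.index := by
  induction h using Subgroup.closure_induction with
  | mem g hg =>
    obtain ⟨a, ha, rfl⟩ := hg
    exact ⟨[(a, true)], rfl, by simpa using ha⟩
  | one => exact ⟨[], rfl, by simp⟩
  | mul g h _ _ ihg ihh =>
    obtain ⟨u, rfl, hu⟩ := ihg
    obtain ⟨v, rfl, hv⟩ := ihh
    refine ⟨u ++ v, mk_append u v, fun l hl => ?_⟩
    rcases List.mem_append.1 hl with hl | hl
    · exact hu l hl
    · exact hv l hl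
  | inv g _ ih =>
    obtain ⟨u, rfl, hu⟩ := ih
    refine ⟨FreeGroup.invRev u, FreeGroup.inv_mk.symm, fun l hl => ?_⟩
    simp only [FreeGroup.invRev, List.mem_reverse, List.mem_map] at hl
    obtain ⟨l', hl', rfl⟩ := hl
    exact hu l' hl'

theorem gapHom_mem_above (m n : ℕ) : ∀ (j : ℕ) (v : FreeGroup Sym), gapHom m n j v ∈ above j := by
  induction n with
  | zero => exact fun j v => one_mem _
  | succ n ih =>
    intro j v
    rw [gapHom, MonoidHom.comp_apply]
    generalize insertLevel m (j + 1) v = g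
    have : (FreeGroup.lift (Sum.elim (fun c => gapHom m n (j + 1) (FreeGroup.of c))
        fun b => FreeGroup.of (genOf (j + 1) b))).range ≤ above j := by
      refine FreeGroup.range_lift_le ?_
      rintro _ ⟨c | b, rfl⟩
      · exact above_antitone (Nat.le_succ j) (ih (j + 1) _)
      · refine of_mem_above ?_
        cases b <;> simp [genOf, Gen.index]
    exact this ⟨g, rfl⟩

/-- The gaps are words in letters of index above `j + 1`, so the letters of level `j + 1` play the
part of `β` and the splitting applies. -/
theorem exists_regionProd_gapHom (m n j : ℕ) (v : FreeGroup Sym) :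
    ∃ s us, RegionProd s us (insertLevel m (j + 1) v) ∧
      s + (us.map fun u => cancellationNorm (gapHom m n (j + 1) u)).sum ≤
        cancellationNorm (gapHom m (n + 1) j v) := by
  choose rw h1 h2 using fun c : Sym =>
    exists_word_of_mem_above (gapHom_mem_above m n (j + 1) (FreeGroup.of c))
  have hι : Function.Injective (genOf (j + 1)) := by
    intro a b h
    cases a <;> cases b <;> simp_all [genOf]
  obtain ⟨s, us, h3, h4⟩ := exists_regionProd hι (rw := rw) (fun c l hl => by
    rintro ⟨b, hb⟩
    have := h2 c l hl
    rw [← hb] at this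
    cases b <;> simp [genOf, Gen.index] at this) (insertLevel m (j + 1) v)
  refine ⟨s, us, h3, ?_⟩
  simp only [h1] at h4
  have e : FreeGroup.lift (fun c => gapHom m n (j + 1) (FreeGroup.of c)) =
      gapHom m n (j + 1) := by
    ext; simp
  rw [e] at h4
  exact h4

end Levels

end CancellationNorm
namespace CancellationNorm

/-! ### Counting nontrivial regions -/

section Counting

theorem eq_one_or_eq_prod_of_countP_le_one {ι A : Type*} [CommMonoid A] [DecidableEq A]
    (φ : ι → A) (us : List ι) (h : us.countP (fun u => φ u ≠ 1) ≤ 1) :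
    ∀ u ∈ us, φ u = 1 ∨ φ u = (us.map φ).prod := by
  have key : ∀ us : List ι, us.countP (fun u => φ u ≠ 1) = 0 → (us.map φ).prod = 1 := by
    intro us h
    refine List.prod_eq_one fun a ha => ?_
    obtain ⟨u, hu, rfl⟩ := List.mem_map.1 ha
    simpa using List.countP_eq_zero.1 h u hu
  induction us with
  | nil => simp
  | cons a us ih =>
    intro u hu
    by_cases ha : φ a = 1
    · have h' : us.countP (fun u => φ u ≠ 1) ≤ 1 := by
        rwa [List.countP_cons_of_neg (by simpa using ha)] at h
      rcases List.mem_cons.1 hu with rfl | hu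
      · exact Or.inl ha
      · rcases ih h' u hu with h1 | h1
        · exact Or.inl h1
        · right
          rw [h1, List.map_cons, List.prod_cons, ha, one_mul]
    · have h0 : us.countP (fun u => φ u ≠ 1) = 0 := by
        rw [List.countP_cons_of_pos (by simpa using ha)] at h
        omega
      rcases List.mem_cons.1 hu with rfl | hu
      · right
        rw [List.map_cons, List.prod_cons, key us h0, mul_one]
      · left
        simpa using List.countP_eq_zero.1 h0 u hu

theorem exists_ne_one_of_prod_ne_one {ι A : Type*} [CommMonoid A] (φ : ι → A) (us : List ι)
    (h : (us.map φ).prod ≠ 1) : ∃ u ∈ us, φ u ≠ 1 := by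
  by_contra! hcon
  refine h (List.prod_eq_one fun a ha => ?_)
  obtain ⟨u, hu, rfl⟩ := List.mem_map.1 ha
  exact hcon u hu

theorem prod_map_flatMap {ι κ A : Type*} [CommMonoid A] (φ : κ → A) (U : ι → List κ)
    (us : List ι) :
    ((us.flatMap U).map φ).prod = (us.map fun u => ((U u).map φ).prod).prod := by
  induction us with
  | nil => simp
  | cons a us ih => simp [ih]

theorem sum_map_flatMap {ι κ : Type*} (φ : κ → ℕ) (U : ι → List κ) (us : List ι) :
    ((us.flatMap U).map φ).sum = (us.map fun u => ((U u).map φ).sum).sum := by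
  induction us with
  | nil => simp
  | cons a us ih => simp [ih]

theorem countP_le_countP_flatMap {ι κ : Type*} (p : ι → Bool) (r : κ → Bool) (U : ι → List κ)
    (us : List ι) (h : ∀ u ∈ us, p u = true → 1 ≤ (U u).countP r) :
    us.countP p ≤ (us.flatMap U).countP r := by
  induction us with
  | nil => simp
  | cons a us ih =>
    have := ih fun u hu => h u (List.mem_cons_of_mem _ hu)
    rw [List.flatMap_cons, List.countP_append, List.countP_cons]
    split_ifs with ha
    · have := h a List.mem_cons_self ha
      omega
    · omega

theorem countP_le_countP_flatMap_of_mem {ι κ : Type*} (r : κ → Bool) (U : ι → List κ)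
    {us : List ι} {u : ι} (hu : u ∈ us) : (U u).countP r ≤ (us.flatMap U).countP r := by
  obtain ⟨l₁, l₂, rfl⟩ := List.append_of_mem hu
  simp only [List.flatMap_append, List.flatMap_cons, List.countP_append]
  omega

end Counting

/-! ### Exponents modulo 4 and their characters -/

section Exponents

/-- The exponents modulo `4` with which the twisted elements of later odd and even index occur. -/
def expMod : FreeGroup Sym →* Multiplicative (ZMod 4 × ZMod 4) :=
  FreeGroup.lift fun c => match c with
    | Sym.r => Multiplicative.ofAdd (1, 1)
    | Sym.e => Multiplicative.ofAdd (0, 1)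
    | Sym.o => Multiplicative.ofAdd (1, 0)

/-- The reduction modulo `2` of pairs of exponents modulo `4`. -/
def pairParity : Multiplicative (ZMod 4 × ZMod 4) →* Multiplicative (ZMod 2 × ZMod 2) :=
  AddMonoidHom.toMultiplicative
    (((ZMod.castHom (by decide : 2 ∣ 4) (ZMod 2)).toAddMonoidHom).prodMap
      (ZMod.castHom (by decide : 2 ∣ 4) (ZMod 2)).toAddMonoidHom)

theorem blockCount_insOdd (v : FreeGroup Sym) :
    ((Multiplicative.toAdd (blockCount insOdd v) : ℤ) : ZMod 4) =
      (Multiplicative.toAdd (expMod v)).1 := by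
  have : (AddMonoidHom.toMultiplicative (Int.castAddHom (ZMod 4))).comp (blockCount insOdd) =
      (AddMonoidHom.toMultiplicative (AddMonoidHom.fst (ZMod 4) (ZMod 4))).comp expMod := by
    ext c
    cases c <;> simp [blockCount, insOdd, expMod]
  exact DFunLike.congr_fun this v

theorem blockCount_insEven (v : FreeGroup Sym) :
    ((Multiplicative.toAdd (blockCount insEven v) : ℤ) : ZMod 4) =
      (Multiplicative.toAdd (expMod v)).2 := by
  have : (AddMonoidHom.toMultiplicative (Int.castAddHom (ZMod 4))).comp (blockCount insEven) =
      (AddMonoidHom.toMultiplicative (AddMonoidHom.snd (ZMod 4) (ZMod 4))).comp expMod := by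
    ext c
    cases c <;> simp [blockCount, insEven, expMod]
  exact DFunLike.congr_fun this v

/-- The imaginary unit among the Gaussian integers. -/
def gaussI : GaussianIntˣ := ⟨⟨0, 1⟩, ⟨0, -1⟩, by decide, by decide⟩

/-- The powers of the imaginary unit, with exponents modulo `4`. -/
def gaussIPow : Multiplicative (ZMod 4) →* GaussianIntˣ where
  toFun k := gaussI ^ (Multiplicative.toAdd k).val
  map_one' := by decide
  map_mul' := by decide

/-- The character of pairs of exponents given by two weights. -/
def pairChar (p q : ZMod 4) : Multiplicative (ZMod 4 × ZMod 4) →* GaussianIntˣ :=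
  gaussIPow.comp (AddMonoidHom.toMultiplicative
    ((AddMonoidHom.mulLeft p).comp (AddMonoidHom.fst _ _) +
      (AddMonoidHom.mulLeft q).comp (AddMonoidHom.snd _ _)))

theorem pairChar_apply (p q : ZMod 4) (c : Multiplicative (ZMod 4 × ZMod 4)) :
    pairChar p q c = gaussIPow (Multiplicative.ofAdd
      (p * (Multiplicative.toAdd c).1 + q * (Multiplicative.toAdd c).2)) := rfl

/-- A single nontrivial region would carry the whole class `c`, on which the character is trivial.
-/
theorem two_le_countP_of_pairChar {p q : ZMod 4} {us : List (FreeGroup Sym)}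
    {c : Multiplicative (ZMod 4 × ZMod 4)} (hc : (us.map expMod).prod = c)
    (h1 : pairChar p q c = 1) (h2 : ∃ u ∈ us, pairChar p q (expMod u) ≠ 1) :
    2 ≤ us.countP (fun u => expMod u ≠ 1) := by
  by_contra! hlt
  obtain ⟨u, hu, hne⟩ := h2
  rcases eq_one_or_eq_prod_of_countP_le_one expMod us (by omega) u hu with h | h
  · exact hne (by rw [h, map_one])
  · exact hne (by rw [h, hc, h1])

theorem castHom_four_two (z : ℤ) :
    ((z : ℤ) : ZMod 2) = ZMod.castHom (by decide : 2 ∣ 4) (ZMod 2) ((z : ℤ) : ZMod 4) := by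
  simp

end Exponents

/-! ### Quadratic lower bound -/

section LowerBound

/-- One level of the splitting: the regions `us`, at the cost of `s` letters. -/
structure IsSplitting (m n j : ℕ) (v : FreeGroup Sym) (s : ℕ) (us : List (FreeGroup Sym)) :
    Prop where
  cost : s + (us.map fun u => cancellationNorm (gapHom m n (j + 1) u)).sum ≤
    cancellationNorm (gapHom m (n + 1) j v)
  prod_eq : (us.map expMod).prod = expMod v

theorem exists_isSplitting_odd {m n j : ℕ} (hm : m ≠ 0) (hj : Odd (j + 1))
    (v : FreeGroup Sym) :
    ∃ s us, IsSplitting m n j v s us ∧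
      ((Multiplicative.toAdd (expMod v)).1 ≠ 0 → 2 ≤ s) ∧
      ∀ p q : ZMod 4, q - p = 2 → pairChar p q (expMod v) = 1 →
        ZMod.castHom (by decide : 2 ∣ 4) (ZMod 2) (Multiplicative.toAdd (expMod v)).1 ≠ 0 →
        2 * m ≤ s ∨ 2 ≤ us.countP (fun u => expMod u ≠ 1) := by
  obtain ⟨s, us, h1, h2⟩ := exists_regionProd_gapHom m n j v
  rw [insertLevel, if_pos hj] at h1
  refine ⟨s, us, ⟨h2, h1.prod_map_eq expMod⟩, fun h => ?_, fun p q hpq hχ hodd => ?_⟩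
  · refine h1.two_le hm fun h0 => h ?_
    rw [← blockCount_insOdd, h0]
    rfl
  · have hq : ((pairChar p q).comp expMod) (FreeGroup.of Sym.e * (FreeGroup.of Sym.o)⁻¹) = -1 := by
      have : pairChar p q (expMod (FreeGroup.of Sym.e * (FreeGroup.of Sym.o)⁻¹)) =
          gaussIPow (Multiplicative.ofAdd (q - p)) := by
        rw [pairChar_apply]
        congr 2
        simp [expMod]
        ring
      rw [MonoidHom.comp_apply, this, hpq]
      decide
    rcases h1.two_mul_le_or ((pairChar p q).comp expMod) hq hχ
        (by rwa [castHom_four_two, blockCount_insOdd]) with h | h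
    · exact Or.inl h
    · exact Or.inr (two_le_countP_of_pairChar (h1.prod_map_eq expMod) hχ h)

theorem exists_isSplitting_even {m n j : ℕ} (hm : m ≠ 0) (hj : ¬ Odd (j + 1))
    (v : FreeGroup Sym) :
    ∃ s us, IsSplitting m n j v s us ∧
      ((Multiplicative.toAdd (expMod v)).2 ≠ 0 → 2 ≤ s) ∧
      ∀ p q : ZMod 4, p + q = 2 → pairChar p q (expMod v) = 1 →
        ZMod.castHom (by decide : 2 ∣ 4) (ZMod 2) (Multiplicative.toAdd (expMod v)).2 ≠ 0 →
        2 * m ≤ s ∨ 2 ≤ us.countP (fun u => expMod u ≠ 1) := by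
  obtain ⟨s, us, h1, h2⟩ := exists_regionProd_gapHom m n j v
  rw [insertLevel, if_neg hj] at h1
  refine ⟨s, us, ⟨h2, h1.prod_map_eq expMod⟩, fun h => ?_, fun p q hpq hχ hodd => ?_⟩
  · refine h1.two_le hm fun h0 => h ?_
    rw [← blockCount_insEven, h0]
    rfl
  · have hq : ((pairChar p q).comp expMod) (FreeGroup.of Sym.r) = -1 := by
      have : pairChar p q (expMod (FreeGroup.of Sym.r)) =
          gaussIPow (Multiplicative.ofAdd (p + q)) := by
        rw [pairChar_apply]
        congr 2
        simp [expMod]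
      rw [MonoidHom.comp_apply, this, hpq]
      decide
    rcases h1.two_mul_le_or ((pairChar p q).comp expMod) hq hχ
        (by rwa [castHom_four_two, blockCount_insEven]) with h | h
    · exact Or.inl h
    · exact Or.inr (two_le_countP_of_pairChar (h1.prod_map_eq expMod) hχ h)

/-- Write `c = (a, b)`. If just one exponent is odd, the level of that parity works. If both are
odd, the odd level works for `a = b` and the even level for `a = -b`; modulo 4 one of the two holds.
-/
theorem exists_weights : ∀ c : Multiplicative (ZMod 4 × ZMod 4), pairParity c ≠ 1 →
    (∃ p q : ZMod 4, q - p = 2 ∧ pairChar p q c = 1 ∧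
      ZMod.castHom (by decide : 2 ∣ 4) (ZMod 2) (Multiplicative.toAdd c).1 ≠ 0) ∨
    (∃ p q : ZMod 4, p + q = 2 ∧ pairChar p q c = 1 ∧
      ZMod.castHom (by decide : 2 ∣ 4) (ZMod 2) (Multiplicative.toAdd c).2 ≠ 0) := by
  decide

/-- Two successive levels, of odd and of even index, taken together. -/
theorem exists_splitting_pair {m : ℕ} (n : ℕ) {j : ℕ} (hm : m ≠ 0) (hj : Even j)
    (v : FreeGroup Sym) :
    ∃ (s : ℕ) (us : List (FreeGroup Sym)),
      s + (us.map fun u => cancellationNorm (gapHom m n (j + 2) u)).sum ≤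
        cancellationNorm (gapHom m (n + 2) j v) ∧
      (us.map expMod).prod = expMod v ∧ (expMod v ≠ 1 → 2 ≤ s) ∧
      (pairParity (expMod v) ≠ 1 → 2 * m ≤ s ∨ 2 ≤ us.countP (fun u => expMod u ≠ 1)) := by
  obtain ⟨s, us, ⟨h1, h2⟩, h3, h4⟩ := exists_isSplitting_odd (n := n + 1) hm hj.add_one v
  have hj2 : ¬ Odd (j + 1 + 1) := by
    rw [Nat.not_odd_iff_even]
    exact hj.add_one.add_one
  choose S U hU hS hχ using fun u =>
    exists_isSplitting_even (m := m) (n := n) (j := j + 1) hm hj2 u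
  have hprod : ((us.flatMap U).map expMod).prod = expMod v := by
    rw [prod_map_flatMap, ← h2]
    congr 1
    exact List.map_congr_left fun u _ => (hU u).prod_eq
  have hcount : us.countP (fun u => expMod u ≠ 1) ≤
      (us.flatMap U).countP (fun u => expMod u ≠ 1) := by
    refine countP_le_countP_flatMap _ _ U us fun u _ hu => ?_
    have hne : ((U u).map expMod).prod ≠ 1 := by
      rw [(hU u).prod_eq]
      simpa using hu
    obtain ⟨w, hw, hw1⟩ := exists_ne_one_of_prod_ne_one expMod _ hne
    exact List.countP_pos_iff.2 ⟨w, hw, by simpa using hw1⟩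
  have hSle : ∀ u ∈ us, S u ≤ (us.map S).sum := fun u hu =>
    List.le_sum_of_mem (List.mem_map_of_mem hu)
  refine ⟨s + (us.map S).sum, us.flatMap U, ?_, hprod, ?_, ?_⟩
  · rw [sum_map_flatMap]
    have : (us.map S).sum + (us.map fun u =>
        ((U u).map fun u => cancellationNorm (gapHom m n (j + 2) u)).sum).sum ≤
        (us.map fun u => cancellationNorm (gapHom m (n + 1) (j + 1) u)).sum := by
      rw [← List.sum_map_add]
      exact List.sum_le_sum fun u _ => (hU u).cost
    change _ ≤ cancellationNorm (gapHom m (n + 1 + 1) j v)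
    omega
  · intro hv
    -- If the odd level sees nothing, the even exponent is nonzero and survives in some region,
    -- which pays at the even level.
    by_cases ha : (Multiplicative.toAdd (expMod v)).1 = 0
    · have hb : ∃ u ∈ us, (Multiplicative.toAdd (expMod u)).2 ≠ 0 := by
        have hb : ((us.map fun u => Multiplicative.ofAdd
            (Multiplicative.toAdd (expMod u)).2).prod) ≠ 1 := by
          have e : (us.map fun u => Multiplicative.ofAdd
              (Multiplicative.toAdd (expMod u)).2).prod =
              AddMonoidHom.toMultiplicative (AddMonoidHom.snd (ZMod 4) (ZMod 4)) (expMod v) := by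
            rw [← h2, map_list_prod, List.map_map]
            rfl
          rw [e]
          intro h0
          exact hv (Multiplicative.toAdd.injective (Prod.ext ha h0))
        obtain ⟨u, hu, hu1⟩ := exists_ne_one_of_prod_ne_one _ _ hb
        exact ⟨u, hu, fun h0 => hu1 (by rw [h0]; rfl)⟩
      obtain ⟨u, hu, hub⟩ := hb
      have := hS u hub
      have := hSle u hu
      omega
    · have := h3 ha
      omega
  · intro hv
    by_cases h2c : 2 ≤ us.countP (fun u => expMod u ≠ 1)
    · exact Or.inr (h2c.trans hcount)
    rcases exists_weights _ hv with ⟨p, q, hpq, hp1, hp2⟩ | ⟨p, q, hpq, hp1, hp2⟩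
    · rcases h4 p q hpq hp1 hp2 with h | h
      · left
        omega
      · exact absurd h h2c
    -- Fewer than two nontrivial regions came out of the odd level, so exactly one did. It inherits
    -- the class of `v`, and the character for the even level can be used on it.
    · have hne : (us.map expMod).prod ≠ 1 := by
        rw [h2]
        intro h0
        exact hv (by rw [h0, map_one])
      obtain ⟨u, hu, hu1⟩ := exists_ne_one_of_prod_ne_one expMod us hne
      have huv : expMod u = expMod v := by
        rcases eq_one_or_eq_prod_of_countP_le_one expMod us (by omega) u hu with h | h
        · exact absurd h hu1
        · rw [h, h2]
      rcases hχ u p q hpq (by rw [huv, hp1]) (by rw [huv]; exact hp2) with h | h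
      · left
        have := hSle u hu
        omega
      · exact Or.inr (h.trans (countP_le_countP_flatMap_of_mem _ U hu))

/-- Without truncated subtraction: `N` nontrivial regions, one of them with an odd exponent, cost at
least `2kN + k(k-1)` over `k` pairs of levels. -/
theorem le_sum_cancellationNorm {m : ℕ} (hm : m ≠ 0) (k : ℕ) : ∀ (j : ℕ)
    (vs : List (FreeGroup Sym)), Even j → k ≤ m → (∃ v ∈ vs, pairParity (expMod v) ≠ 1) →
    2 * k * vs.countP (fun v => expMod v ≠ 1) + k * k ≤
      (vs.map fun v => cancellationNorm (gapHom m (2 * k) j v)).sum + k := by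
  induction k with
  | zero => simp
  | succ k ih =>
    intro j vs hj hk hvs
    choose S U h1 h2 h3 h4 using fun v => exists_splitting_pair (2 * k) hm hj v
    have hpar : ∃ u ∈ vs.flatMap U, pairParity (expMod u) ≠ 1 := by
      obtain ⟨v, hv, hv1⟩ := hvs
      have : ((U v).map fun u => pairParity (expMod u)).prod ≠ 1 := by
        rw [← h2 v, map_list_prod, List.map_map] at hv1
        exact hv1
      obtain ⟨u, hu, hu1⟩ := exists_ne_one_of_prod_ne_one _ _ this
      exact ⟨u, List.mem_flatMap.2 ⟨v, hv, hu⟩, hu1⟩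
    have h5 := ih (j + 2) (vs.flatMap U) (hj.add (by decide)) (by omega) hpar
    rw [sum_map_flatMap] at h5
    have h6 : (vs.map S).sum + (vs.map fun v => ((U v).map fun u =>
        cancellationNorm (gapHom m (2 * k) (j + 2) u)).sum).sum ≤
        (vs.map fun v => cancellationNorm (gapHom m (2 * (k + 1)) j v)).sum := by
      rw [← List.sum_map_add]
      exact List.sum_le_sum fun v _ => h1 v
    have hpos : ∀ v, expMod v ≠ 1 → 1 ≤ (U v).countP (fun u => expMod u ≠ 1) := by
      intro v hv
      rw [← h2 v] at hv
      obtain ⟨w, hw, hw1⟩ := exists_ne_one_of_prod_ne_one expMod _ hv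
      exact List.countP_pos_iff.2 ⟨w, hw, by simpa using hw1⟩
    have gen : ∀ l : List (FreeGroup Sym), 2 * l.countP (fun v => expMod v ≠ 1) ≤
        (l.map S).sum ∧ l.countP (fun v => expMod v ≠ 1) ≤
          (l.flatMap U).countP (fun v => expMod v ≠ 1) := by
      intro l
      refine ⟨?_, countP_le_countP_flatMap _ _ U l fun v _ hv => hpos v (by simpa using hv)⟩
      induction l with
      | nil => simp
      | cons a l ih =>
        rw [List.countP_cons, List.map_cons, List.sum_cons]
        split_ifs with ha
        · have := h3 a (by simpa using ha)
          omega
        · omega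
    -- The region with an odd exponent either adds a region, worth `2k` over the remaining `k`
    -- pairs, or pays `2m` instead of `2`; the surplus `2m - 2` is at least `2k` because `k + 1 ≤
    -- m`.
    have hmain : (2 * vs.countP (fun v => expMod v ≠ 1) ≤ (vs.map S).sum ∧
        vs.countP (fun v => expMod v ≠ 1) + 1 ≤
          (vs.flatMap U).countP (fun v => expMod v ≠ 1)) ∨
        (2 * vs.countP (fun v => expMod v ≠ 1) + 2 * m ≤ (vs.map S).sum + 2 ∧
        vs.countP (fun v => expMod v ≠ 1) ≤
          (vs.flatMap U).countP (fun v => expMod v ≠ 1)) := by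
      obtain ⟨v, hv, hv1⟩ := hvs
      have hve : expMod v ≠ 1 := fun h0 => hv1 (by rw [h0, map_one])
      obtain ⟨l₁, l₂, rfl⟩ := List.append_of_mem hv
      have g1 := gen l₁
      have g2 := gen l₂
      have g3 := h3 v hve
      have g4 := hpos v hve
      simp only [List.countP_append, List.map_append, List.sum_append, List.flatMap_append,
        List.map_cons, List.sum_cons, List.flatMap_cons]
      rw [List.countP_cons_of_pos (by simpa using hve)]
      rcases h4 v hv1 with h | h
      · right
        omega
      · left
        omega
    generalize vs.countP (fun v => expMod v ≠ 1) = N at *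
    generalize (vs.flatMap U).countP (fun v => expMod v ≠ 1) = N' at *
    have hk' : k + 1 ≤ m := hk
    rcases hmain with ⟨ha, hb⟩ | ⟨ha, hb⟩
    · have := Nat.mul_le_mul_left (2 * k) hb
      nlinarith
    · have := Nat.mul_le_mul_left (2 * k) hb
      nlinarith

theorem le_cancellationNorm_gapR {k m : ℕ} (hm : m ≠ 0) (hk : k ≤ m) {j : ℕ} (hj : Even j) :
    k * k + k ≤ cancellationNorm (gapR m (2 * k) j) := by
  have hne : pairParity (expMod (FreeGroup.of Sym.r)) ≠ 1 := by
    simp only [expMod, FreeGroup.lift_apply_of]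
    decide
  have := le_sum_cancellationNorm hm k j [FreeGroup.of Sym.r] hj hk
    ⟨_, List.mem_singleton_self _, hne⟩
  rw [List.countP_cons_of_pos (by simpa using fun h0 => hne (by rw [h0, map_one]))] at this
  simp only [List.countP_nil, List.map_cons, List.map_nil, List.sum_cons, List.sum_nil] at this
  rw [gapR]
  omega

end LowerBound

end CancellationNorm
namespace CancellationNorm

/-! ### Length of the substituted word -/

section WordLength

/-- The element `g` is represented by a word of length `k`. -/
def HasWord {α : Type*} (g : FreeGroup α) (k : ℕ) : Prop :=
  ∃ w : List (α × Bool), FreeGroup.mk w = g ∧ w.length = k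

variable {α : Type*}

theorem HasWord.of (a : α) : HasWord (FreeGroup.of a) 1 := ⟨[(a, true)], rfl, rfl⟩

theorem HasWord.mul {g h : FreeGroup α} {k l : ℕ} (hg : HasWord g k) (hh : HasWord h l) :
    HasWord (g * h) (k + l) := by
  obtain ⟨u, rfl, rfl⟩ := hg
  obtain ⟨v, rfl, rfl⟩ := hh
  exact ⟨u ++ v, mk_append u v, List.length_append⟩

theorem HasWord.inv {g : FreeGroup α} {k : ℕ} (hg : HasWord g k) : HasWord g⁻¹ k := by
  obtain ⟨u, rfl, rfl⟩ := hg
  exact ⟨FreeGroup.invRev u, FreeGroup.inv_mk.symm, FreeGroup.invRev_length⟩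

theorem HasWord.pow {g : FreeGroup α} {k : ℕ} (hg : HasWord g k) (n : ℕ) :
    HasWord (g ^ n) (n * k) := by
  induction n with
  | zero => exact ⟨[], by simp, by simp⟩
  | succ n ih =>
    rw [pow_succ, Nat.succ_mul]
    exact ih.mul hg

theorem HasWord.map {β : Type*} {φ : FreeGroup α →* FreeGroup β} {d : ℕ}
    (hφ : ∀ a, HasWord (φ (FreeGroup.of a)) d) {g : FreeGroup α} {k : ℕ} (hg : HasWord g k) :
    HasWord (φ g) (d * k) := by
  obtain ⟨w, rfl, rfl⟩ := hg
  induction w with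
  | nil => exact ⟨[], by simp, by simp⟩
  | cons l w ih =>
    rw [mk_cons, map_mul, List.length_cons, Nat.mul_succ, add_comm]
    refine HasWord.mul ?_ ih
    rcases l with ⟨a, _ | _⟩
    · have : (FreeGroup.mk [(a, false)] : FreeGroup α) = (FreeGroup.of a)⁻¹ := rfl
      rw [this, map_inv]
      exact (hφ a).inv
    · exact hφ a

theorem hasWord_T (m j : ℕ) : HasWord (T m j) (4 * m) := by
  have hx : HasWord (x j) 1 := HasWord.of _
  have hy : HasWord (y j) 1 := HasWord.of _
  have := ((hx.mul hy).pow m).mul ((hy.mul hx).pow m).inv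
  rwa [show m * (1 + 1) + m * (1 + 1) = 4 * m by ring] at this

theorem hasWord_f_of (m j : ℕ) (a : Gen) : HasWord (f m j (FreeGroup.of a)) (4 * m + 1) := by
  simp only [f, FreeGroup.lift_apply_of]
  split_ifs
  · exact (hasWord_T m j).inv.mul (HasWord.of a)
  · rw [add_comm]
    exact (HasWord.of a).mul (hasWord_T m j)

theorem hasWord_fComp (m j n : ℕ) (a : Gen) :
    HasWord (fComp m j n (FreeGroup.of a)) ((4 * m + 1) ^ n) := by
  induction n with
  | zero => exact HasWord.of a
  | succ n ih =>
    rw [fComp, MonoidHom.comp_apply, pow_succ']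
    exact ih.map (hasWord_f_of m _)

end WordLength

/-! ### Killing letters in a factorization -/

section Kill

variable {α : Type*} (p : α → Prop) [DecidablePred p]

/-- The endomorphism that keeps the letters with `p` and kills the others. -/
def keepHom : FreeGroup α →* FreeGroup α :=
  FreeGroup.lift fun a => if p a then FreeGroup.of a else 1

theorem IsConjProd.keepHom {ls : List (α × Bool)} {g : FreeGroup α} (h : IsConjProd ls g) :
    IsConjProd (ls.filter fun l => p l.1) (keepHom p g) := by
  induction h with
  | one => simpa using IsConjProd.one
  | cons l c _ ih =>
    rw [map_mul, map_mul, map_mul, map_inv]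
    by_cases hl : p l.1
    · have e : CancellationNorm.keepHom p (FreeGroup.mk [l]) = FreeGroup.mk [l] := by
        rcases l with ⟨a, _ | _⟩ <;>
          simp_all [CancellationNorm.keepHom, FreeGroup.of, FreeGroup.inv_mk, FreeGroup.invRev]
      rw [e, List.filter_cons_of_pos (by simpa using hl)]
      exact IsConjProd.cons l _ ih
    · have e : CancellationNorm.keepHom p (FreeGroup.mk [l]) = 1 := by
        rcases l with ⟨a, _ | _⟩ <;> simp_all [CancellationNorm.keepHom]
      rw [e, List.filter_cons_of_neg (by simpa using hl)]
      simpa using ih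

theorem IsConjProd.exists_mem_of_keepHom_ne_one {ls : List (α × Bool)} {g : FreeGroup α}
    (h : IsConjProd ls g) (hg : CancellationNorm.keepHom p g ≠ 1) : ∃ l ∈ ls, p l.1 := by
  by_contra! hcon
  have h' := h.keepHom p
  rw [List.filter_eq_nil_iff.2 (by simpa using fun a b hab => hcon (a, b) hab)] at h'
  generalize CancellationNorm.keepHom p g = g' at h' hg
  cases h'
  exact hg rfl

end Kill

/-! ### Lower bounds from projections -/

section Projections

theorem keepHom_eq_self_of_mem_above {p : Gen → Prop} [DecidablePred p] {j : ℕ}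
    (h : ∀ a : Gen, j < a.index → p a) {g : F} (hg : g ∈ above j) : keepHom p g = g := by
  have : above j ≤ (keepHom p).eqLocus (MonoidHom.id F) := by
    rw [above, Subgroup.closure_le]
    rintro _ ⟨a, ha, rfl⟩
    simp [keepHom, MonoidHom.eqLocus, h a ha]
  exact this hg

theorem keepHom_eq_one_of_mem_above {p : Gen → Prop} [DecidablePred p] {j : ℕ}
    (h : ∀ a : Gen, j < a.index → ¬ p a) {g : F} (hg : g ∈ above j) : keepHom p g = 1 := by
  have : above j ≤ (keepHom p).ker := by
    rw [above, Subgroup.closure_le]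
    rintro _ ⟨a, ha, rfl⟩
    simp [keepHom, MonoidHom.mem_ker, h a ha]
  exact this hg

/-- Killing everything but `x_i` shows that every factorization uses that letter; killing `x_i` then
leaves a strictly shorter factorization of `g`. -/
theorem cancellationNorm_x_mul {i j : ℕ} (hij : i ≤ j) {g : F} (hg : g ∈ above j) :
    cancellationNorm g + 1 ≤ cancellationNorm (x i * g) := by
  obtain ⟨ls, h1, h2⟩ := exists_isConjProd (x i * g)
  have h3 := h2.keepHom (fun a => a ≠ Gen.x i)
  have e1 : keepHom (fun a => a ≠ Gen.x i) (x i * g) = g := by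
    rw [map_mul, keepHom_eq_self_of_mem_above (j := j) ?_ hg]
    · simp [keepHom, x]
    · rintro a ha rfl
      simp [Gen.index] at ha
      omega
  have e2 : keepHom (fun a => a = Gen.x i) (x i * g) ≠ 1 := by
    rw [map_mul, keepHom_eq_one_of_mem_above (j := j) ?_ hg]
    · simp [keepHom, x]
    · rintro a ha rfl
      simp [Gen.index] at ha
      omega
  rw [e1] at h3
  obtain ⟨l, hl, hl'⟩ := h2.exists_mem_of_keepHom_ne_one _ e2
  have h4 := h3.cancellationNorm_le
  have h5 : (ls.filter fun l => l.1 ≠ Gen.x i).length < ls.length :=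
    List.length_filter_lt_length_iff_exists.2 ⟨l, hl, by simp [hl']⟩
  omega

/-- At the level of index `j` the surrounding gaps die and the block becomes `T_j`; at every earlier
level the block has `x = y = 1` and dies. -/
theorem keepHom_index_gapR (m n : ℕ) : ∀ i j : ℕ, i < j → j ≤ i + n →
    keepHom (fun a : Gen => a.index = j) (gapR m n i) = T m j := by
  induction n with
  | zero =>
    intro i j h1 h2
    omega
  | succ n ih =>
    intro i j hij hjn
    set κ := keepHom (fun a : Gen => a.index = j) with hκ
    by_cases hj : i + 1 = j
    · have h1 : ∀ v, κ (gapHom m n (i + 1) v) = 1 := fun v =>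
        keepHom_eq_one_of_mem_above (fun a ha hp => by omega) (gapHom_mem_above m n (i + 1) v)
      have hx : κ (x (i + 1)) = x j := by simp [hκ, keepHom, x, Gen.index, hj]
      have hy : κ (y (i + 1)) = y j := by simp [hκ, keepHom, y, Gen.index, hj]
      by_cases ho : Odd (i + 1)
      · rw [gapR_succ_odd ho, map_mul, twistOdd, map_mul, map_mul, map_twist, map_inv, map_mul,
          map_inv, gapR, gapO, gapE, h1, h1, h1, hx, hy, T_eq_twist]
        simp
      · rw [gapR_succ_even ho, map_mul, twistEven, map_twist, gapR, h1, hx, hy, T_eq_twist,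
          one_mul]
    · have hx : κ (x (i + 1)) = 1 := by simp [hκ, keepHom, x, Gen.index, hj]
      have hy : κ (y (i + 1)) = 1 := by simp [hκ, keepHom, y, Gen.index, hj]
      have h2 := ih (i + 1) j (by omega) (by omega)
      by_cases ho : Odd (i + 1)
      · rw [gapR_succ_odd ho, map_mul, h2, twistOdd, map_mul, map_mul, map_twist, hx, hy,
          twist_self, map_inv]
        simp
      · rw [gapR_succ_even ho, map_mul, h2, twistEven, map_twist, hx, hy, twist_self, mul_one]

theorem le_cancellationNorm_wBar_sq {m : ℕ} (hm : 2 ≤ m) :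
    2 * m - 2 ≤ cancellationNorm (wBar m ^ 2) := by
  obtain ⟨ls, h1, h2⟩ := exists_isConjProd (wBar m ^ 2)
  have hsub : Finset.Icc 3 (2 * m) ⊆ (ls.map fun l => l.1.index).toFinset := by
    intro j hj
    rw [Finset.mem_Icc] at hj
    have hne : keepHom (fun a : Gen => a.index = j) (wBar m ^ 2) ≠ 1 := by
      have hx : keepHom (fun a : Gen => a.index = j) (x 0) = 1 :=
        (FreeGroup.lift_apply_of).trans (if_neg (show ¬ 0 = j by omega))
      rw [map_pow, wBar_eq, map_mul, keepHom_index_gapR m _ 2 j (by omega) (by omega), hx,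
        one_mul, T_eq_twist]
      intro h0
      exact twist_of_ne_one (by omega) (by simp)
        ((pow_eq_one_iff_left two_ne_zero).1 h0)
    obtain ⟨l, hl, hl'⟩ := h2.exists_mem_of_keepHom_ne_one _ hne
    rw [List.mem_toFinset]
    exact List.mem_map.2 ⟨l, hl, hl'⟩
  have h3 := Finset.card_le_card hsub
  have h4 := List.toFinset_card_le (ls.map fun l => l.1.index)
  rw [List.length_map] at h4
  rw [Nat.card_Icc] at h3
  omega

end Projections

end CancellationNorm
namespace CancellationNorm

/-! ### The bi-invariant distance -/

section Near

variable {α : Type*} [DecidableEq α] {k l : ℕ} {g h g' h' : FreeGroup α}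

/-- The elements `g` and `h` are at distance at most `k` in the metric of the cancellation norm. -/
def Near (k : ℕ) (g h : FreeGroup α) : Prop := cancellationNorm (g * h⁻¹) ≤ k

theorem cancellationNorm_conj_eq (g h : FreeGroup α) :
    cancellationNorm (h * g * h⁻¹) = cancellationNorm g := by
  refine le_antisymm (cancellationNorm_conj_le g h) ?_
  have := cancellationNorm_conj_le (h * g * h⁻¹) h⁻¹
  rwa [show h⁻¹ * (h * g * h⁻¹) * h⁻¹⁻¹ = g by group] at this

theorem Near.cancellationNorm_le (h₁ : Near k g h) :
    cancellationNorm g ≤ k + cancellationNorm h := by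
  have := cancellationNorm_mul_le (g * h⁻¹) h
  rw [inv_mul_cancel_right] at this
  unfold Near at h₁
  omega

theorem Near.mul_right (h₁ : Near k g h) (c : FreeGroup α) : Near k (g * c) (h * c) := by
  unfold Near at *
  rwa [show g * c * (h * c)⁻¹ = g * h⁻¹ by group]

theorem Near.mul_left (h₁ : Near k g h) (c : FreeGroup α) : Near k (c * g) (c * h) := by
  unfold Near at *
  rwa [show c * g * (c * h)⁻¹ = c * (g * h⁻¹) * c⁻¹ by group, cancellationNorm_conj_eq]

theorem Near.trans {c : FreeGroup α} (h₁ : Near k g h) (h₂ : Near l h c) : Near (k + l) g c := by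
  unfold Near at *
  have := cancellationNorm_mul_le (g * h⁻¹) (h * c⁻¹)
  rw [show g * h⁻¹ * (h * c⁻¹) = g * c⁻¹ by group] at this
  omega

theorem Near.mul (h₁ : Near k g h) (h₂ : Near l g' h') : Near (k + l) (g * g') (h * h') :=
  (h₁.mul_right g').trans (h₂.mul_left h)

theorem Near.pow (h₁ : Near k g h) (n : ℕ) : Near (n * k) (g ^ n) (h ^ n) := by
  induction n with
  | zero => simp [Near]
  | succ n ih =>
    rw [pow_succ, pow_succ, Nat.succ_mul]
    exact ih.mul h₁

theorem near_mk_singleton (l : α × Bool) : Near 1 (FreeGroup.mk [l]) 1 := by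
  simpa [Near] using cancellationNorm_mk_singleton_le l

theorem near_of (a : α) : Near 1 (FreeGroup.of a) 1 := near_mk_singleton _

theorem near_of_inv (a : α) : Near 1 (FreeGroup.of a)⁻¹ 1 := near_mk_singleton (a, false)

end Near

/-! ### Cheap deletions in a twisted element -/

section TwistDeletions

/-- Take `w = (x q y q)^(m-1)`. The first form uses `(y q x q)^m = y q w x q`; the second moves `w`
past `x q y q`, with which it commutes. Each form shows letters whose deletion makes most of the
word cancel. -/
theorem exists_twist_eq {G : Type*} [Group G] {m : ℕ} (hm : m ≠ 0) (x y q : G) :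
    ∃ w : G, twist m x y q = w * x * q * y * x⁻¹ * w⁻¹ * q⁻¹ * y⁻¹ ∧
      twist m x y q = x * (q * y * q * w * q⁻¹) * x⁻¹ * w⁻¹ * q⁻¹ * y⁻¹ := by
  obtain ⟨n, rfl⟩ := Nat.exists_eq_succ_of_ne_zero hm
  have hw : (x * q * y * q) ^ n * (x * q * y * q) = x * q * y * q * (x * q * y * q) ^ n :=
    (Commute.refl (x * q * y * q)).pow_left n
  have hv : (y * q * x * q) ^ (n + 1) = y * q * (x * q * y * q) ^ n * x * q := by
    have : SemiconjBy (y * q) (x * q * y * q) (y * q * x * q) := by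
      simp only [SemiconjBy, mul_assoc]
    have h := this.pow_right n
    rw [h.eq, pow_succ]
    group
  have h1 : twist (n + 1) x y q = (x * q * y * q) ^ n * x * q * y * x⁻¹ *
      ((x * q * y * q) ^ n)⁻¹ * q⁻¹ * y⁻¹ := by
    rw [twist, hv, pow_succ]
    group
  refine ⟨(x * q * y * q) ^ n, h1, ?_⟩
  rw [h1]
  generalize (x * q * y * q) ^ n = w at hw
  rw [show w * x * q * y = w * (x * q * y * q) * q⁻¹ by group, hw]
  group

variable {α : Type*} [DecidableEq α] {m : ℕ} (a b : α) (q : FreeGroup α)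

theorem exists_near_twist_commutator (hm : m ≠ 0) :
    ∃ g, Near 2 (twist m (FreeGroup.of a) (FreeGroup.of b) q) (g * q * g⁻¹ * q⁻¹) := by
  obtain ⟨w, h, -⟩ := exists_twist_eq hm (FreeGroup.of a) (FreeGroup.of b) q
  refine ⟨w * FreeGroup.of a, ?_⟩
  rw [h]
  have := (((((near_of b).mul_left (w * FreeGroup.of a * q)).mul_right (FreeGroup.of a)⁻¹).mul_right
    w⁻¹).mul_right q⁻¹).mul (near_of_inv b)
  convert this using 1
  group

theorem exists_near_twist_commutator' (hm : m ≠ 0) :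
    ∃ g, Near 2 (twist m (FreeGroup.of a) (FreeGroup.of b) q) (q * g * q⁻¹ * g⁻¹) := by
  obtain ⟨w, -, h⟩ := exists_twist_eq hm (FreeGroup.of a) (FreeGroup.of b) q
  refine ⟨FreeGroup.of b * q * w, ?_⟩
  rw [h]
  have := (((((near_of a).mul_right (q * FreeGroup.of b * q * w * q⁻¹)).mul
    (near_of_inv a)).mul_right w⁻¹).mul_right q⁻¹).mul_right (FreeGroup.of b)⁻¹
  convert this using 1
  group

theorem exists_near_inv_twist_commutator (hm : m ≠ 0) :
    ∃ g, Near 2 (twist m (FreeGroup.of a) (FreeGroup.of b) q)⁻¹ (q * g * q⁻¹ * g⁻¹) := by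
  obtain ⟨w, h, -⟩ := exists_twist_eq hm (FreeGroup.of a) (FreeGroup.of b) q
  refine ⟨w * FreeGroup.of a, ?_⟩
  rw [h]
  have := (((near_of b).mul_right (q * w * FreeGroup.of a)).mul (near_of_inv b)).mul_right
    (q⁻¹ * (FreeGroup.of a)⁻¹ * w⁻¹)
  convert this using 1 <;> group

/-- The same `g` serves both estimates, so two copies of the block can be made to cancel around what
lies between them. -/
theorem exists_near_twist_pair (hm : m ≠ 0) :
    ∃ g, Near 2 (twist m (FreeGroup.of a) (FreeGroup.of b) q) g ∧
      Near 2 (twist m (FreeGroup.of a) (FreeGroup.of b) q) (q * g⁻¹ * q⁻¹) := by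
  obtain ⟨w, h, h'⟩ := exists_twist_eq hm (FreeGroup.of a) (FreeGroup.of b) q
  refine ⟨w * FreeGroup.of a * q * w⁻¹ * q⁻¹ * (FreeGroup.of b)⁻¹, ?_, ?_⟩
  · rw [h]
    have := (((((near_of b).mul_left (w * FreeGroup.of a * q)).mul (near_of_inv a)).mul_right
      w⁻¹).mul_right q⁻¹).mul_right (FreeGroup.of b)⁻¹
    convert this using 1
    group
  · rw [h']
    have := (((((near_of a).mul_right (q * FreeGroup.of b * q * w * q⁻¹)).mul_right
      (FreeGroup.of a)⁻¹).mul_right w⁻¹).mul_right q⁻¹).mul (near_of_inv b)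
    convert this using 1
    group

theorem near_twist_one : Near (4 * m) (twist m (FreeGroup.of a) (FreeGroup.of b) q) 1 := by
  have h1 := (((((near_of a).mul_right q).mul (near_of b)).mul_right q).pow m)
  have h2 := ((((near_of_inv a).mul_left q⁻¹).mul_right q⁻¹).mul (near_of_inv b)).pow m
  have h := h1.mul h2
  rw [show m * (1 + 1) + m * (1 + 1) = 4 * m by ring] at h
  convert h using 1
  · rw [twist, ← inv_pow]
    congr 2
    group
  · simp only [one_mul, mul_one]
    rw [← mul_inv_rev, inv_pow, mul_inv_cancel]

end TwistDeletions

/-! ### Upper bounds level by level -/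

section UpperBounds

variable {m n j : ℕ}

theorem cancellationNorm_mul_twist_le (hm : m ≠ 0) (i : ℕ) (q : F) :
    cancellationNorm (q * twist m (x i) (y i) q) ≤ 2 + cancellationNorm q := by
  obtain ⟨g, hg⟩ := exists_near_twist_commutator (Gen.x i) (Gen.y i) q hm
  have h := (hg.mul_left q).cancellationNorm_le
  rwa [show q * (g * q * g⁻¹ * q⁻¹) = (q * g) * q * (q * g)⁻¹ by group,
    cancellationNorm_conj_eq] at h

theorem cancellationNorm_twist_one_le (hm : m ≠ 0) (i : ℕ) :
    cancellationNorm (twist m (x i) (y i) 1) ≤ 2 := by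
  simpa using cancellationNorm_mul_twist_le hm i 1

theorem cancellationNorm_gapR_succ_even_le (hm : m ≠ 0) (hj : ¬ Odd (j + 1)) :
    cancellationNorm (gapR m (n + 1) j) ≤ 2 + cancellationNorm (gapR m n (j + 1)) := by
  rw [gapR_succ_even hj]
  exact cancellationNorm_mul_twist_le hm _ _

theorem cancellationNorm_gapR_succ_odd_le (hj : Odd (j + 1)) :
    cancellationNorm (gapR m (n + 1) j) ≤ 4 * m + cancellationNorm (gapR m n (j + 1)) := by
  rw [gapR_succ_odd hj, twistOdd]
  have h := (((near_twist_one (m := m) (Gen.x (j + 1)) (Gen.y (j + 1))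
    (gapE m n (j + 1) * (gapO m n (j + 1))⁻¹)).mul_left (gapO m n (j + 1))⁻¹).mul_right
    (gapO m n (j + 1))).mul_left (gapR m n (j + 1))
  have h' := h.cancellationNorm_le
  rwa [mul_one, inv_mul_cancel, mul_one] at h'

theorem gapR_two (hj : Even j) : gapR m 2 j = twist m (x (j + 2)) (y (j + 2)) 1 *
    twist m (x (j + 1)) (y (j + 1)) (twist m (x (j + 2)) (y (j + 2)) 1) := by
  have h1 : Odd (j + 1) := hj.add_one
  have h2 : ¬ Odd (j + 1 + 1) := by simpa using h1.add_one
  rw [gapR_succ_odd h1, twistOdd, gapR_succ_even h2, gapE_succ_even h2, gapO_succ_even h2,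
    twistEven]
  simp

theorem cancellationNorm_gapR_two_le (hm : m ≠ 0) (hj : Even j) :
    cancellationNorm (gapR m 2 j) ≤ 4 := by
  rw [gapR_two hj]
  have h1 := cancellationNorm_mul_twist_le hm (j + 1) (twist m (x (j + 2)) (y (j + 2)) 1)
  have h2 := cancellationNorm_twist_one_le hm (j + 2)
  omega

theorem gapR_four (hj : Even j) {b c d : F} (hd : d = twist m (x (j + 4)) (y (j + 4)) 1)
    (hc : c = twist m (x (j + 3)) (y (j + 3)) d)
    (hb : b = twist m (x (j + 2)) (y (j + 2)) (d * c)) :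
    gapR m 4 j = d * c * b * c⁻¹ * twist m (x (j + 1)) (y (j + 1)) (d * b * c⁻¹) * c := by
  have h1 : Odd (j + 1) := hj.add_one
  have h2 : ¬ Odd (j + 1 + 1) := by simpa using h1.add_one
  have h3 : Odd (j + 1 + 1 + 1) := (Nat.not_odd_iff_even.1 h2).add_one
  have h4 : ¬ Odd (j + 1 + 1 + 1 + 1) := by simpa using h3.add_one
  have e : gapR m 2 (j + 1 + 1) = d * c := by
    rw [gapR_two (by simpa using h2), hc, hd]
  have hE : gapE m 3 (j + 1) = d * b := by
    rw [gapE_succ_even h2, twistEven, gapE_succ_odd h3, gapE_succ_even h4, twistEven, e, hb, hd]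
    simp
  have hO : gapO m 3 (j + 1) = c := by
    rw [gapO_succ_even h2, gapO_succ_odd h3, gapO_succ_even h4, twistOdd, gapE_succ_even h4,
      gapO_succ_even h4, twistEven, hc, hd]
    simp
  rw [gapR_succ_odd h1, twistOdd, gapR_succ_even h2, twistEven, e, hE, hO, hb]
  group

/-- The cost is `2 + 6 + 4 + 4`: turn the outer block into a commutator with `d b c⁻¹`, replace one
`b` by `d c` so that this element becomes `d²`, delete `d²`, and cancel the remaining `d c d⁻¹ c`.
-/
theorem cancellationNorm_gapR_four_le (hm : m ≠ 0) (hj : Even j) :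
    cancellationNorm (gapR m 4 j) ≤ 16 := by
  obtain ⟨d, hd⟩ : ∃ d, d = twist m (x (j + 4)) (y (j + 4)) 1 := ⟨_, rfl⟩
  obtain ⟨c, hc⟩ : ∃ c, c = twist m (x (j + 3)) (y (j + 3)) d := ⟨_, rfl⟩
  obtain ⟨b, hb⟩ : ∃ b, b = twist m (x (j + 2)) (y (j + 2)) (d * c) := ⟨_, rfl⟩
  rw [gapR_four hj hd hc hb]
  obtain ⟨g, hg⟩ := exists_near_twist_commutator (Gen.x (j + 1)) (Gen.y (j + 1)) (d * b * c⁻¹) hm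
  obtain ⟨a, ha⟩ := exists_near_twist_commutator' (Gen.x (j + 2)) (Gen.y (j + 2)) (d * c) hm
  obtain ⟨k, hk⟩ := exists_near_inv_twist_commutator (Gen.x (j + 3)) (Gen.y (j + 3)) d hm
  obtain ⟨e, he, he'⟩ := exists_near_twist_pair (Gen.x (j + 3)) (Gen.y (j + 3)) d hm
  change Near 2 (twist m (x (j + 2)) (y (j + 2)) (d * c)) _ at ha
  change Near 2 (twist m (x (j + 3)) (y (j + 3)) d)⁻¹ _ at hk
  change Near 2 (twist m (x (j + 3)) (y (j + 3)) d) _ at he he'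
  rw [← hb] at ha
  rw [← hc] at hk he he'
  have hd1 : Near 2 d 1 := by
    simpa [Near, hd] using cancellationNorm_twist_one_le hm (j + 4)
  -- Turn `b` into `(d c) a (d c)⁻¹ a⁻¹`, then `c⁻¹` into `d k d⁻¹ k⁻¹`, then delete the inner
  -- `d⁻¹`; each move costs 2.
  have hb1 : Near 6 b (d * c) := by
    have h1 := ((hk.mul_right d⁻¹).mul_left (d * c * a)).mul_right a⁻¹
    have h2 : Near 2 (d * c * a * (d * k * d⁻¹ * k⁻¹ * d⁻¹) * a⁻¹) (d * c) := by
      have hdi : Near 2 d⁻¹ 1 := by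
        obtain ⟨u, hu⟩ := exists_near_inv_twist_commutator (Gen.x (j + 4)) (Gen.y (j + 4)) 1 hm
        rw [hd]
        rw [one_mul, inv_one, mul_one, mul_inv_cancel] at hu
        exact hu
      convert (((hdi.mul_left (d * c * a * d * k)).mul_right (k⁻¹ * d⁻¹ * a⁻¹))) using 1 <;> group
    have h0 : Near 2 b (d * c * a * (c⁻¹ * d⁻¹) * a⁻¹) := by
      convert ha using 1
      group
    exact (h0.trans h1).trans h2
  have s1 := (hg.mul_left (d * c * b * c⁻¹)).mul_right c
  have s2 := (hb1.mul_left (d * c * b * c⁻¹ * g * d)).mul_right (c⁻¹ * g⁻¹ * c * b⁻¹ * d⁻¹ * c)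
  have s3 := ((hd1.mul hd1).mul_left (d * c * b * c⁻¹ * g)).mul_right
    (g⁻¹ * c * b⁻¹ * d⁻¹ * c)
  have s4 := ((he.mul_left d).mul_right d⁻¹).mul he'
  have t1 : Near 8 (d * c * b * c⁻¹ * twist m (x (j + 1)) (y (j + 1)) (d * b * c⁻¹) * c)
      (d * c * b * c⁻¹ * g * (d * d) * (g⁻¹ * c * b⁻¹ * d⁻¹ * c)) := by
    refine s1.trans (k := 2) (l := 6) ?_
    convert s2 using 1 <;> group
  have t2 := t1.trans s3
  -- The two copies of `c` are replaced by `e` and `d e⁻¹ d⁻¹`, which makes `d c d⁻¹ c` trivial.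
  have t3 : Near 16 (d * c * b * c⁻¹ * twist m (x (j + 1)) (y (j + 1)) (d * b * c⁻¹) * c) 1 := by
    refine t2.trans (l := 4) ?_
    convert s4 using 1 <;> group
  simpa using t3.cancellationNorm_le

theorem cancellationNorm_gapR_le (hm : m ≠ 0) (k : ℕ) : ∀ {j : ℕ}, Even j →
    cancellationNorm (gapR m (2 * (k + 2)) j) ≤ 16 + k * (4 * m + 2) := by
  induction k with
  | zero =>
    intro j hj
    simpa using cancellationNorm_gapR_four_le hm hj
  | succ k ih =>
    intro j hj
    have h1 : Odd (j + 1) := hj.add_one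
    have h2 : ¬ Odd (j + 1 + 1) := by simpa using h1.add_one
    have h3 := ih (j := j + 1 + 1) (by simpa using h2)
    have h4 := cancellationNorm_gapR_succ_even_le (n := 2 * (k + 2)) hm h2
    have h5 := cancellationNorm_gapR_succ_odd_le (m := m) (n := 2 * (k + 2) + 1) h1
    rw [show 2 * (k + 1 + 2) = 2 * (k + 2) + 1 + 1 by ring, Nat.succ_mul k]
    omega

/-- An odd block cancels in the first product and an even block only conjugates the second. In the
other product two copies occur, and `exists_near_twist_pair` turns them into a conjugation at cost
`2 + 2`. -/
theorem cancellationNorm_gap_add_le (hm : m ≠ 0) (n : ℕ) : ∀ j : ℕ,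
    cancellationNorm (gapR m n j * ((gapO m n j)⁻¹ * gapE m n j)) +
      cancellationNorm (((gapO m n j)⁻¹ * gapE m n j)⁻¹ * gapR m n j) ≤ 4 * n := by
  induction n with
  | zero =>
    intro j
    simp
  | succ n ih =>
    intro j
    have h := ih (j + 1)
    by_cases hj : Odd (j + 1)
    · rw [gapR_succ_odd hj, gapE_succ_odd hj, gapO_succ_odd hj, twistOdd]
      generalize gapR m n (j + 1) = r at *
      generalize gapE m n (j + 1) = e at *
      generalize gapO m n (j + 1) = o at *
      obtain ⟨g, hg, hg'⟩ := exists_near_twist_pair (Gen.x (j + 1)) (Gen.y (j + 1)) (e * o⁻¹) hm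
      change Near 2 (twist m (x (j + 1)) (y (j + 1)) (e * o⁻¹)) _ at hg hg'
      generalize twist m (x (j + 1)) (y (j + 1)) (e * o⁻¹) = t at *
      have h1 : cancellationNorm (((o * (o⁻¹ * t * o))⁻¹ * e)⁻¹ * (r * (o⁻¹ * t * o))) ≤
          4 + cancellationNorm ((o⁻¹ * e)⁻¹ * r) := by
        have h2 := ((hg'.mul_left e⁻¹).mul_right (o * r * o⁻¹)).mul (hg.mul_right o)
        have h3 := h2.cancellationNorm_le
        rw [show e⁻¹ * (e * o⁻¹ * g⁻¹ * (e * o⁻¹)⁻¹) * (o * r * o⁻¹) * (g * o) =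
          (o⁻¹ * g⁻¹ * o) * ((o⁻¹ * e)⁻¹ * r) * (o⁻¹ * g⁻¹ * o)⁻¹ by group,
          cancellationNorm_conj_eq] at h3
        convert h3 using 2
        group
      rw [show r * (o⁻¹ * t * o) * ((o * (o⁻¹ * t * o))⁻¹ * e) = r * (o⁻¹ * e) by group]
      omega
    · rw [gapR_succ_even hj, gapE_succ_even hj, gapO_succ_even hj, twistEven]
      generalize gapR m n (j + 1) = r at *
      generalize gapE m n (j + 1) = e at *
      generalize gapO m n (j + 1) = o at *
      obtain ⟨g, hg, hg'⟩ := exists_near_twist_pair (Gen.x (j + 1)) (Gen.y (j + 1)) r hm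
      change Near 2 (twist m (x (j + 1)) (y (j + 1)) r) _ at hg hg'
      generalize twist m (x (j + 1)) (y (j + 1)) r = t at *
      have h1 : cancellationNorm (r * t * (o⁻¹ * (e * t))) ≤
          4 + cancellationNorm (r * (o⁻¹ * e)) := by
        have h2 := ((hg.mul_left r).mul_right (o⁻¹ * e)).mul hg'
        have h3 := h2.cancellationNorm_le
        rw [show r * g * (o⁻¹ * e) * (r * g⁻¹ * r⁻¹) =
          (r * g * r⁻¹) * (r * (o⁻¹ * e)) * (r * g * r⁻¹)⁻¹ by group,
          cancellationNorm_conj_eq] at h3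
        convert h3 using 2
        group
      rw [show (o⁻¹ * (e * t))⁻¹ * (r * t) = t⁻¹ * ((o⁻¹ * e)⁻¹ * r) * t⁻¹⁻¹ by group,
        cancellationNorm_conj_eq]
      omega

end UpperBounds

end CancellationNorm

theorem mainTheorem3 (m : ℕ) (hm : 2 ≤ m) :
    (∃ w : List (CancellationNorm.Gen × Bool),
      FreeGroup.mk w = CancellationNorm.wBar m ∧ w.length = (4 * m + 1) ^ (2 * m - 2)) ∧
    ((m : ℤ) ^ 2 - 3 * m + 5 ≤ CancellationNorm.cancellationNorm (CancellationNorm.wBar m) ∧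
      (CancellationNorm.cancellationNorm (CancellationNorm.wBar m) : ℤ)
        ≤ 4 * (m : ℤ) ^ 2 - 8 * m + 5) ∧
    (2 * (m : ℤ) - 2 ≤ CancellationNorm.cancellationNorm (CancellationNorm.wBar m ^ 2) ∧
      (CancellationNorm.cancellationNorm (CancellationNorm.wBar m ^ 2) : ℤ)
        ≤ 8 * (m : ℤ) - 4) := by
  open CancellationNorm in
  have hm0 : m ≠ 0 := by omega
  have hx : Near 1 (x 0) 1 := near_of _
  refine ⟨hasWord_fComp m 2 (2 * m - 2) (Gen.x 0), ⟨?_, ?_⟩, ?_, ?_⟩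
  · have h1 := le_cancellationNorm_gapR (k := m - 1) hm0 (by omega) even_two
    have h2 := cancellationNorm_x_mul (i := 0) (Nat.zero_le 2)
      (gapHom_mem_above m (2 * (m - 1)) 2 (FreeGroup.of Sym.r))
    rw [wBar_eq, show 2 * m - 2 = 2 * (m - 1) by omega]
    obtain ⟨k, rfl⟩ : ∃ k, m = k + 1 := ⟨m - 1, by omega⟩
    rw [Nat.add_sub_cancel] at *
    -- With `k = m - 1` this is `m² - m + 1`, which exceeds the required bound by `2(m - 2)`.
    have h3 : k * k + k + 1 ≤ cancellationNorm (x 0 * gapR (k + 1) (2 * k) 2) :=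
      le_trans (Nat.succ_le_succ h1) h2
    have h4 : 1 ≤ k := by omega
    zify at h3 h4
    push_cast
    nlinarith
  · have h1 := (hx.mul_right (gapR m (2 * m - 2) 2)).cancellationNorm_le
    rw [one_mul, ← wBar_eq] at h1
    -- For `m = 2` there are only two levels, and the two-level bound 4 is used; from `m = 3` on,
    -- the four-level bound starts the induction.
    rcases hm.eq_or_lt with rfl | hm3
    · have h2 := cancellationNorm_gapR_two_le hm0 even_two
      norm_num at h1 ⊢
      omega
    · obtain ⟨k, rfl⟩ : ∃ k, m = k + 3 := ⟨m - 3, by omega⟩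
      have h2 := cancellationNorm_gapR_le hm0 k even_two
      rw [show 2 * (k + 3) - 2 = 2 * (k + 2) by omega] at h1
      have h3 := h1.trans (Nat.add_le_add_left h2 1)
      zify at h3
      push_cast
      nlinarith
  · have := le_cancellationNorm_wBar_sq hm
    omega
  · have h1 := ((hx.mul_right (gapR m (2 * m - 2) 2)).pow 2).cancellationNorm_le
    rw [one_mul, ← wBar_eq] at h1
    have h2 := cancellationNorm_gap_add_le hm0 (2 * m - 2) 2
    -- Inserting `c c⁻¹` with `c = O⁻¹ E` between the two factors `R` splits `R²` into the two
    -- products controlled jointly by `h2`.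
    have h3 := cancellationNorm_mul_le
      (gapR m (2 * m - 2) 2 * ((gapO m (2 * m - 2) 2)⁻¹ * gapE m (2 * m - 2) 2))
      (((gapO m (2 * m - 2) 2)⁻¹ * gapE m (2 * m - 2) 2)⁻¹ * gapR m (2 * m - 2) 2)
    rw [mul_assoc, mul_inv_cancel_left, ← sq] at h3
    omega
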